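/- **Target-source termination-preserving strong bisimulation.** *Conventions.* Source and intermediate terms are identified up to renaming of bound variables; sequences of variables $\tilde x=x_1,\dots,x_n$ ($n\ge 0$) consist of distinct variables; tuples may be empty; substitution of tuples for sequences of variables is simultaneous and capture-avoiding. *Source calculus.* Terms: $t,u ::= x \mid t\,u \mid \pi_i t \mid \lambda\tilde x.t \mid \langle t_1,\dots,t_n\rangle$. Values: abstractions and tuples of values. Root rules: $(\lambda\tilde x.t)\,\langle v_1,\dots,v_m\rangle \to_{\beta_v} t\{\tilde x:=\vec v\}$ if $|\tilde x|=m$; $\pi_i\langle v_1,\dots,v_m\rangle\to_\pi v_i$ if $1\le i\le m$ (with all $v_j$ values). *Intermediate terms.* As source terms, but abstractions are replaced by closures $[\tilde y;\tilde x.\,t\mid b]$, where the disjoint sequences $\tilde y,\tilde x$ are bound in $t$ and not in the bag $b$ (a tuple). *Target calculus.* Terms: $t,u ::= \pi_i\mathtt l\mid\pi_i\mathtt s\mid \pi_i t\mid\langle t_1,\dots,t_k\rangle\mid t\,u\mid [n,m,t\mid b]$, where $n,m\in\mathbb N$ and the bag $b$ is a tuple of projected variables ($\pi_i\mathtt l$,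 $\pi_i\mathtt s$) or a tuple of values. Values: closures $[n,m,t\mid b]$ and tuples of values. The special variables $\mathtt l,\mathtt s$ are bound by a closure in its body $t$, but not in its bag. A term is *closed* if no $\pi_i\mathtt l$ or $\pi_i\mathtt s$ occurs out of closure bodies. It is *well-formed* if for each of its closures $[n,m,t\mid b]$ one has $|b|=n$, and every $\pi_i\mathtt l$ (resp. $\pi_i\mathtt s$) occurring in $t$ out of closure bodies has $i\le n$ (resp. $i\le m$). Root rules: $[n,m,t\mid\vec v]\,\vec w\to_{\mathtt t\beta_v}t\{\mathtt l:=\vec v,\mathtt s:=\vec w\}$ if $|\vec v|=n$ and $|\vec w|=m$, where the substitution replaces $\pi_i\mathtt l$ by $v_i$ and $\pi_i\mathtt s$ by $w_i$, acting on the bags but not on the bodies of closures; $\pi_i\langle v_1,\dots,v_k\rangle\to_{\mathtt t\pi}v_i$ if $1\le i\le k$ (with all $v_j, w_j$ values). In the source and in the target calculus the root rules are closed under the evaluation contexts $C::=\langle\cdot\rangle\mid t\,C\mid C\,v\mid\pi_iC\mid\langle t_1,\dots,t_k,C,v_1,\dots,v_h\rangle$. A term is *normal* if it has no step of either kind. *Translations*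 (all commute with the constructors that are not mentioned). - Wrapping $\underline{\cdot}$ (source to intermediate): $\underline{\lambda\tilde x.t}=[\tilde y;\tilde x.\,\underline t\mid\langle\tilde y\rangle]$, where $\tilde y$ is the sequence of free variables of $\lambda\tilde x.t$. - Name elimination (intermediate to target) w.r.t. disjoint sequences $\tilde y,\tilde x$ covering the free variables: $\mathsf{el}_{\tilde y,\tilde x}(y_i)=\pi_i\mathtt l$, $\mathsf{el}_{\tilde y,\tilde x}(x_i)=\pi_i\mathtt s$, $\mathsf{el}_{\tilde y,\tilde x}([\tilde z;\tilde w.\,t\mid b])=[|\tilde z|,|\tilde w|,\mathsf{el}_{\tilde z,\tilde w}(t)\mid\mathsf{el}_{\tilde y,\tilde x}(b)]$. - Naming (target to intermediate): $\mathsf{nm}_{\tilde y,\tilde x}(\pi_i\mathtt l)=y_i$, $\mathsf{nm}_{\tilde y,\tilde x}(\pi_i\mathtt s)=x_i$, $\mathsf{nm}_{\tilde y,\tilde x}([n,m,t\mid b])=[\tilde z;\tilde w.\,\mathsf{nm}_{\tilde z,\tilde w}(t)\mid\mathsf{nm}_{\tilde y,\tilde x}(b)]$ with $\tilde z,\tilde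 w$ fresh and disjoint, $|\tilde z|=n$, $|\tilde w|=m$. - Unwrapping (intermediate to source): $\mathsf{un}([\tilde y;\tilde x.\,t\mid b])=\lambda\tilde x.\,\mathsf{un}(t)\{\tilde y:=\mathsf{un}(b)\}$ (so $\lambda\tilde x.\,\mathsf{un}(t)$ when $b=\langle\tilde y\rangle$). Write $R(t)=\mathsf{un}(\mathsf{nm}_{\epsilon,\epsilon}(t))$, where $\epsilon$ is the empty sequence. **Theorem.** Let $t$ be a closed well-formed target term. 1. *Projection*: if $t\to_{\mathtt t\beta_v}u$ then $R(t)\to_{\beta_v}R(u)$, and if $t\to_{\mathtt t\pi}u$ then $R(t)\to_\pi R(u)$. 2. *Halt*: $t$ is normal if and only if $R(t)$ is normal. 3. *Reflection*: if $R(t)\to_{\beta_v}u$ then there is $s$ with $t\to_{\mathtt t\beta_v}s$ and $R(s)=u$, and if $R(t)\to_\pi u$ then there is $s$ with $t\to_{\mathtt t\pi}s$ and $R(s)=u$. 4. *Inverse*: if $u$ is a closed source term, then $R(\mathsf{el}_{\epsilon,\epsilon}(\underline u))=u$. -/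

import Mathlib

/-!
Three call-by-value calculi with tuples (source, intermediate, target) and the translations
between them.

Source and intermediate terms are identified up to renaming of bound variables.  This is rendered
by the locally nameless representation: free variables are names, and the `i`-th variable of the
`k`-th enclosing sequence of binders (counted from the inside) is `bvar k i`.  Equality of such
terms is equality up to renaming.

Positions are counted from `0` everywhere: `proj i` stands for the projection on the `(i+1)`-th
component.
-/

namespace ClosureConversion

/-- Names of variables. -/
abbrev Name : Type := ℕ

/-- A sequence of `n` pairwise distinct names, none of which is in `avoid`. -/
def freshNames (avoid : List Name) (n : ℕ) : List Name :=
  List.range' (avoid.foldr max 0 + 1) n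

/-- The two kinds of steps: beta steps and projection steps. -/
inductive StepKind : Type
  | beta
  | proj

/-! ### The source calculus -/

/-- (Pre)terms of the source calculus; `lam m t` abstracts a sequence of `m` variables in `t`. -/
inductive Src : Type
  | fvar (x : Name)
  | bvar (k i : ℕ)
  | app (t u : Src)
  | proj (i : ℕ) (t : Src)
  | lam (m : ℕ) (t : Src)
  | tup (ts : List Src)

namespace Src

/-- `t.LCAt ctx`: every bound variable of `t` refers to a binder of `t`, or to one of the enclosing
binders, whose lengths are listed in `ctx` (innermost first). -/
inductive LCAt : List ℕ → Src → Prop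
  | fvar (ctx : List ℕ) (x : Name) : LCAt ctx (.fvar x)
  | bvar (ctx : List ℕ) (k i n : ℕ) : ctx[k]? = some n → i < n → LCAt ctx (.bvar k i)
  | app (ctx : List ℕ) (t u : Src) : LCAt ctx t → LCAt ctx u → LCAt ctx (.app t u)
  | proj (ctx : List ℕ) (i : ℕ) (t : Src) : LCAt ctx t → LCAt ctx (.proj i t)
  | lam (ctx : List ℕ) (m : ℕ) (t : Src) : LCAt (m :: ctx) t → LCAt ctx (.lam m t)
  | tup (ctx : List ℕ) (ts : List Src) : (∀ t ∈ ts, LCAt ctx t) → LCAt ctx (.tup ts)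

/-- Proper terms of the source calculus: there are no dangling bound variables. -/
def IsTerm (t : Src) : Prop := LCAt [] t

/-- The free variables, in order of occurrence, possibly with repetitions. -/
def fv : Src → List Name
  | .fvar x => [x]
  | .bvar _ _ => []
  | .app t u => fv t ++ fv u
  | .proj _ t => fv t
  | .lam _ t => fv t
  | .tup ts => ts.flatMap (fun t => fv t)

/-- Closed terms. -/
def IsClosed (t : Src) : Prop := t.fv = []

/-- Replace the `i`-th variable of the `k`-th enclosing binder sequence by the `i`-th element of
`us` (simultaneously for all `i`). -/
def openAt (k : ℕ) (us : List Src) : Src → Src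
  | .fvar x => .fvar x
  | .bvar j i => if j = k then us.getD i (.bvar j i) else .bvar j i
  | .app t u => .app (openAt k us t) (openAt k us u)
  | .proj i t => .proj i (openAt k us t)
  | .lam m t => .lam m (openAt (k + 1) us t)
  | .tup ts => .tup (ts.map (fun t => openAt k us t))

/-- Bind the names `xs` by the `k`-th enclosing binder sequence. -/
def closeAt (k : ℕ) (xs : List Name) : Src → Src
  | .fvar x => if x ∈ xs then .bvar k (xs.idxOf x) else .fvar x
  | .bvar j i => .bvar j i
  | .app t u => .app (closeAt k xs t) (closeAt k xs u)
  | .proj i t => .proj i (closeAt k xs t)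
  | .lam m t => .lam m (closeAt (k + 1) xs t)
  | .tup ts => .tup (ts.map (fun t => closeAt k xs t))

/-- The abstraction of the sequence of names `xs` in `t`. -/
def abs (xs : List Name) (t : Src) : Src := .lam xs.length (closeAt 0 xs t)

/-- Simultaneous capture-avoiding substitution of the terms `us` for the free names `xs`. -/
def subst (xs : List Name) (us : List Src) : Src → Src
  | .fvar x => if x ∈ xs then us.getD (xs.idxOf x) (.fvar x) else .fvar x
  | .bvar j i => .bvar j i
  | .app t u => .app (subst xs us t) (subst xs us u)
  | .proj i t => .proj i (subst xs us t)
  | .lam m t => .lam m (subst xs us t)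
  | .tup ts => .tup (ts.map (fun t => subst xs us t))

/-- Values: abstractions, and tuples of values. -/
inductive IsValue : Src → Prop
  | lam (m : ℕ) (t : Src) : IsValue (.lam m t)
  | tup (vs : List Src) : (∀ v ∈ vs, IsValue v) → IsValue (.tup vs)

/-- Root rewriting rules. -/
inductive RootStep : StepKind → Src → Src → Prop
  | beta (m : ℕ) (t : Src) (vs : List Src) : (∀ v ∈ vs, IsValue v) → m = vs.length →
      RootStep .beta (.app (.lam m t) (.tup vs)) (openAt 0 vs t)
  | proj (i : ℕ) (vs : List Src) (v : Src) : (∀ w ∈ vs, IsValue w) → vs[i]? = some v →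
      RootStep .proj (.proj i (.tup vs)) v

/-- Closure of the root rules under the evaluation contexts
`C ::= ⟨·⟩ | t C | C v | πᵢ C | ⟨t₁, …, tₖ, C, v₁, …, vₕ⟩` (right-to-left weak evaluation). -/
inductive Step (a : StepKind) : Src → Src → Prop
  | root (t u : Src) : RootStep a t u → Step a t u
  | appR (t u u₁ : Src) : Step a u u₁ → Step a (.app t u) (.app t u₁)
  | appL (t t₁ v : Src) : IsValue v → Step a t t₁ → Step a (.app t v) (.app t₁ v)
  | proj (i : ℕ) (t t₁ : Src) : Step a t t₁ → Step a (.proj i t) (.proj i t₁)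
  | tup (ts vs : List Src) (t t₁ : Src) : (∀ v ∈ vs, IsValue v) → Step a t t₁ →
      Step a (.tup (ts ++ t :: vs)) (.tup (ts ++ t₁ :: vs))

/-- Normal forms for the union of beta and projection steps. -/
def IsNormal (t : Src) : Prop := ∀ (a : StepKind) (u : Src), ¬ Step a t u

/-- Number of constructors (a termination measure). -/
def size : Src → ℕ
  | .fvar _ => 1
  | .bvar _ _ => 1
  | .app t u => size t + size u + 1
  | .proj _ t => size t + 1
  | .lam _ t => size t + 1
  | .tup ts => (ts.map (fun t => size t)).sum + 1

theorem size_openAt (xs : List Name) (k : ℕ) (t : Src) :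
    size (openAt k (xs.map Src.fvar) t) = size t := by
  induction k, t using openAt.induct with
  | case1 k x => simp [openAt, size]
  | case2 j i =>
    rcases h : xs[i]? with _ | x <;> simp [openAt, size, List.getD_eq_getElem?_getD, h]
  | case3 k j i h => simp [openAt, size, h]
  | case4 k t u iht ihu => simp [openAt, size, iht, ihu]
  | case5 k i t ih => simp [openAt, size, ih]
  | case6 k m t ih => simp [openAt, size, ih]
  | case7 k ts ih =>
    simp only [openAt, size, List.map_map]
    congr 2
    exact List.map_congr_left ih

theorem size_lt_of_mem {t : Src} {ts : List Src} (h : t ∈ ts) :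
    size t < (ts.map (fun u => size u)).sum + 1 :=
  Nat.lt_succ_of_le (List.le_sum_of_mem (List.mem_map_of_mem (f := fun u => size u) h))

end Src

/-! ### The intermediate calculus -/

/-- (Pre)terms of the intermediate calculus.  The closure `clos n m t b` has body `t` and bag `b`,
and binds in `t` (but not in `b`) a sequence `ys` of `n` wrapped variables and a sequence `xs` of
`m` source variables, as in `λ ys. λ xs. t`: directly in `t`, `bvar 0 i` is the `i`-th variable of
`xs` and `bvar 1 i` is the `i`-th variable of `ys`. -/
inductive Mid : Type
  | fvar (x : Name)
  | bvar (k i : ℕ)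
  | app (t u : Mid)
  | proj (i : ℕ) (t : Mid)
  | tup (ts : List Mid)
  | clos (n m : ℕ) (t : Mid) (b : List Mid)

namespace Mid

/-- The free variables, in order of occurrence, possibly with repetitions. -/
def fv : Mid → List Name
  | .fvar x => [x]
  | .bvar _ _ => []
  | .app t u => fv t ++ fv u
  | .proj _ t => fv t
  | .tup ts => ts.flatMap (fun t => fv t)
  | .clos _ _ t b => fv t ++ b.flatMap (fun u => fv u)

/-- Name the variables of the `k`-th enclosing binder sequence by `xs`. -/
def openAt (k : ℕ) (xs : List Name) : Mid → Mid
  | .fvar x => .fvar x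
  | .bvar j i => if j = k then (xs[i]?.map Mid.fvar).getD (.bvar j i) else .bvar j i
  | .app t u => .app (openAt k xs t) (openAt k xs u)
  | .proj i t => .proj i (openAt k xs t)
  | .tup ts => .tup (ts.map (fun t => openAt k xs t))
  | .clos n m t b => .clos n m (openAt (k + 2) xs t) (b.map (fun u => openAt k xs u))

/-- Bind the names `xs` by the `k`-th enclosing binder sequence. -/
def closeAt (k : ℕ) (xs : List Name) : Mid → Mid
  | .fvar x => if x ∈ xs then .bvar k (xs.idxOf x) else .fvar x
  | .bvar j i => .bvar j i
  | .app t u => .app (closeAt k xs t) (closeAt k xs u)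
  | .proj i t => .proj i (closeAt k xs t)
  | .tup ts => .tup (ts.map (fun t => closeAt k xs t))
  | .clos n m t b => .clos n m (closeAt (k + 2) xs t) (b.map (fun u => closeAt k xs u))

/-- The closure with wrapped variables `ys`, source variables `xs` (disjoint sequences of names),
body `t` and bag `b`. -/
def closure (ys xs : List Name) (t : Mid) (b : List Mid) : Mid :=
  .clos ys.length xs.length (closeAt 1 ys (closeAt 0 xs t)) b

/-- The body of a closure, its wrapped and source variables being named `ys` and `xs`. -/
def openBody (ys xs : List Name) (t : Mid) : Mid := openAt 1 ys (openAt 0 xs t)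

/-- Number of constructors (a termination measure). -/
def size : Mid → ℕ
  | .fvar _ => 1
  | .bvar _ _ => 1
  | .app t u => size t + size u + 1
  | .proj _ t => size t + 1
  | .tup ts => (ts.map (fun t => size t)).sum + 1
  | .clos _ _ t b => size t + (b.map (fun u => size u)).sum + 1

theorem size_openAt (xs : List Name) (k : ℕ) (t : Mid) : size (openAt k xs t) = size t := by
  induction k, t using openAt.induct with
  | case1 k x => simp [openAt, size]
  | case2 j i => rcases h : xs[i]? with _ | x <;> simp [openAt, size, h]
  | case3 k j i h => simp [openAt, size, h]
  | case4 k t u iht ihu => simp [openAt, size, iht, ihu]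
  | case5 k i t ih => simp [openAt, size, ih]
  | case6 k ts ih =>
    simp only [openAt, size, List.map_map]
    congr 2
    exact List.map_congr_left ih
  | case7 k n m t b iht ihb =>
    simp only [openAt, size, List.map_map, iht]
    congr 3
    exact List.map_congr_left ihb

theorem size_openBody (ys xs : List Name) (t : Mid) : size (openBody ys xs t) = size t := by
  simp [openBody, size_openAt]

theorem size_lt_of_mem {t : Mid} {ts : List Mid} (h : t ∈ ts) :
    size t < (ts.map (fun u => size u)).sum + 1 :=
  Nat.lt_succ_of_le (List.le_sum_of_mem (List.mem_map_of_mem (f := fun u => size u) h))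

end Mid

/-! ### The target calculus -/

/-- Terms of the target calculus.  `projL i` and `projS i` are the projected variables, that is,
projections of the two special variables (wrapped and source).  In `clos n m t b`, the two special
variables are bound in the body `t` but not in the bag `b`; `n` and `m` annotate the
number of components that they stand for. -/
inductive Tgt : Type
  | projL (i : ℕ)
  | projS (i : ℕ)
  | proj (i : ℕ) (t : Tgt)
  | tup (ts : List Tgt)
  | app (t u : Tgt)
  | clos (n m : ℕ) (t : Tgt) (b : List Tgt)

namespace Tgt

/-- Projected variables. -/
inductive IsProjVar : Tgt → Prop
  | projL (i : ℕ) : IsProjVar (.projL i)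
  | projS (i : ℕ) : IsProjVar (.projS i)

/-- Values: closures, and tuples of values. -/
inductive IsValue : Tgt → Prop
  | clos (n m : ℕ) (t : Tgt) (b : List Tgt) : IsValue (.clos n m t b)
  | tup (vs : List Tgt) : (∀ v ∈ vs, IsValue v) → IsValue (.tup vs)

/-- Bags: tuples of projected variables, or tuples of values. -/
def IsBag (b : List Tgt) : Prop := (∀ p ∈ b, IsProjVar p) ∨ (∀ v ∈ b, IsValue v)

/-- Wrapped norm: the largest `i + 1` such that `projL i` occurs out of closure bodies, and `0` if
there is none. -/
def normL : Tgt → ℕ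
  | .projL i => i + 1
  | .projS _ => 0
  | .proj _ t => normL t
  | .tup ts => (ts.map (fun t => normL t)).foldr max 0
  | .app t u => max (normL t) (normL u)
  | .clos _ _ _ b => (b.map (fun u => normL u)).foldr max 0

/-- Source norm: the largest `i + 1` such that `projS i` occurs out of closure bodies, and `0` if
there is none. -/
def normS : Tgt → ℕ
  | .projL _ => 0
  | .projS i => i + 1
  | .proj _ t => normS t
  | .tup ts => (ts.map (fun t => normS t)).foldr max 0
  | .app t u => max (normS t) (normS u)
  | .clos _ _ _ b => (b.map (fun u => normS u)).foldr max 0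

/-- Closed terms: no projected variable occurs out of closure bodies. -/
def IsClosed (t : Tgt) : Prop := t.normL = 0 ∧ t.normS = 0

/-- Well-formed terms: every closure `clos n m t b` (also inside bodies and bags) has a bag of one
of the two allowed forms, of length `n`, and its body has wrapped norm at most `n` and source norm
at most `m`. -/
inductive WellFormed : Tgt → Prop
  | projL (i : ℕ) : WellFormed (.projL i)
  | projS (i : ℕ) : WellFormed (.projS i)
  | proj (i : ℕ) (t : Tgt) : WellFormed t → WellFormed (.proj i t)
  | tup (ts : List Tgt) : (∀ t ∈ ts, WellFormed t) → WellFormed (.tup ts)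
  | app (t u : Tgt) : WellFormed t → WellFormed u → WellFormed (.app t u)
  | clos (n m : ℕ) (t : Tgt) (b : List Tgt) : WellFormed t → (∀ u ∈ b, WellFormed u) →
      IsBag b → normL t ≤ n → normS t ≤ m → b.length = n → WellFormed (.clos n m t b)

/-- Projecting substitution of the tuples `vs` and `ws` for the wrapped and the source variable.
(It is only meant for `vs` and `ws` at least as long as the norms of the term.) -/
def psubst (vs ws : List Tgt) : Tgt → Tgt
  | .projL i => vs.getD i (.projL i)
  | .projS i => ws.getD i (.projS i)
  | .proj i t => .proj i (psubst vs ws t)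
  | .tup ts => .tup (ts.map (fun t => psubst vs ws t))
  | .app t u => .app (psubst vs ws t) (psubst vs ws u)
  | .clos n m t b => .clos n m t (b.map (fun u => psubst vs ws u))

/-- Root rewriting rules. -/
inductive RootStep : StepKind → Tgt → Tgt → Prop
  | beta (n m : ℕ) (t : Tgt) (vs ws : List Tgt) :
      (∀ v ∈ vs, IsValue v) → (∀ w ∈ ws, IsValue w) → n = vs.length → m = ws.length →
      RootStep .beta (.app (.clos n m t vs) (.tup ws)) (psubst vs ws t)
  | proj (i : ℕ) (vs : List Tgt) (v : Tgt) : (∀ w ∈ vs, IsValue w) → vs[i]? = some v →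
      RootStep .proj (.proj i (.tup vs)) v

/-- Closure of the root rules under the evaluation contexts
`C ::= ⟨·⟩ | t C | C v | πᵢ C | ⟨t₁, …, tₖ, C, v₁, …, vₕ⟩` (right-to-left weak evaluation). -/
inductive Step (a : StepKind) : Tgt → Tgt → Prop
  | root (t u : Tgt) : RootStep a t u → Step a t u
  | appR (t u u₁ : Tgt) : Step a u u₁ → Step a (.app t u) (.app t u₁)
  | appL (t t₁ v : Tgt) : IsValue v → Step a t t₁ → Step a (.app t v) (.app t₁ v)
  | proj (i : ℕ) (t t₁ : Tgt) : Step a t t₁ → Step a (.proj i t) (.proj i t₁)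
  | tup (ts vs : List Tgt) (t t₁ : Tgt) : (∀ v ∈ vs, IsValue v) → Step a t t₁ →
      Step a (.tup (ts ++ t :: vs)) (.tup (ts ++ t₁ :: vs))

/-- Normal forms for the union of beta and projection steps. -/
def IsNormal (t : Tgt) : Prop := ∀ (a : StepKind) (u : Tgt), ¬ Step a t u

end Tgt

/-! ### The translations -/

/-- Wrapping (source to intermediate).  An abstraction of the variables `xs` becomes a closure
whose wrapped variables are the free variables `ys` of the abstraction, and whose bag is the tuple
of these same variables. -/
def wrap : Src → Mid
  | .fvar x => .fvar x
  | .bvar k i => .bvar k i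
  | .app t u => .app (wrap t) (wrap u)
  | .proj i t => .proj i (wrap t)
  | .lam m t =>
    let ys := t.fv.dedup
    let xs := freshNames t.fv m
    Mid.closure ys xs (wrap (t.openAt 0 (xs.map Src.fvar))) (ys.map Mid.fvar)
  | .tup ts => .tup (ts.map (fun t => wrap t))
termination_by t => t.size
decreasing_by
  all_goals simp only [Src.size, Src.size_openAt]
  all_goals first
    | omega
    | exact Src.size_lt_of_mem (by assumption)

/-- Unwrapping (intermediate to source).  A closure with wrapped variables `ys`, source variables
`xs`, body `t` and bag `b` becomes the abstraction of `xs` in the unwrapping of `t`, where the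
unwrapped elements of `b` are substituted for `ys`.  When `b` is a tuple of distinct variables,
which up to renaming are the `ys` themselves, this is the abstraction of `xs` in the unwrapping
of `t`. -/
def unwrap : Mid → Src
  | .fvar x => .fvar x
  | .bvar k i => .bvar k i
  | .app t u => .app (unwrap t) (unwrap u)
  | .proj i t => .proj i (unwrap t)
  | .tup ts => .tup (ts.map (fun t => unwrap t))
  | .clos n m t b =>
    let avoid := (Mid.clos n m t b).fv
    let ys := freshNames avoid n
    let xs := freshNames (avoid ++ ys) m
    Src.abs xs ((unwrap (t.openBody ys xs)).subst ys (b.map (fun u => unwrap u)))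
termination_by t => t.size
decreasing_by
  all_goals simp only [Mid.size, Mid.size_openBody]
  all_goals first
    | omega
    | exact Mid.size_lt_of_mem (by assumption)
    | exact lt_of_lt_of_le (Mid.size_lt_of_mem (by assumption)) (by omega)

/-- Name elimination (intermediate to target) with respect to the wrapped variables `ys` and the
source variables `xs`.  (It is only meant for terms whose free variables are in `ys` or `xs`.) -/
def nameElim (ys xs : List Name) : Mid → Tgt
  | .fvar z => if z ∈ ys then .projL (ys.idxOf z) else .projS (xs.idxOf z)
  | .bvar _ i => .projS i -- junk: dangling bound variables do not occur in terms
  | .app t u => .app (nameElim ys xs t) (nameElim ys xs u)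
  | .proj i t => .proj i (nameElim ys xs t)
  | .tup ts => .tup (ts.map (fun t => nameElim ys xs t))
  | .clos n m t b =>
    let zs := freshNames t.fv n
    let ws := freshNames (t.fv ++ zs) m
    .clos n m (nameElim zs ws (t.openBody zs ws)) (b.map (fun u => nameElim ys xs u))
termination_by t => t.size
decreasing_by
  all_goals simp only [Mid.size, Mid.size_openBody]
  all_goals first
    | omega
    | exact Mid.size_lt_of_mem (by assumption)
    | exact lt_of_lt_of_le (Mid.size_lt_of_mem (by assumption)) (by omega)

/-- Naming (target to intermediate) with respect to the wrapped variables `ys` and the source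
variables `xs`.  (It is only meant for well-formed terms whose norms are at most the lengths of
`ys` and `xs`.) -/
def naming (ys xs : List Name) : Tgt → Mid
  | .projL i => .fvar (ys.getD i 0)
  | .projS i => .fvar (xs.getD i 0)
  | .proj i t => .proj i (naming ys xs t)
  | .tup ts => .tup (ts.map (fun t => naming ys xs t))
  | .app t u => .app (naming ys xs t) (naming ys xs u)
  | .clos n m t b =>
    let zs := freshNames (ys ++ xs) n
    let ws := freshNames (ys ++ xs ++ zs) m
    Mid.closure zs ws (naming zs ws t) (b.map (fun u => naming ys xs u))

/-- Closure conversion of closed source terms: wrapping, then name elimination. -/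
def closureConversion (u : Src) : Tgt := nameElim [] [] (wrap u)

/-- The reverse translation of closed target terms: naming, then unwrapping. -/
def reverseTranslation (t : Tgt) : Src := unwrap (naming [] [] t)

end ClosureConversion

namespace ClosureConversion

/-! ### Fresh names -/

/-! Naming followed by unwrapping is a single recursive function in disguise. `Tgt.readback` reads a
target term as a source term relative to two environments that give source terms for the projected
variables; a closure is read as an abstraction, its body being read in the environment formed by the
read-back bag and the bound parameters. It chooses no names, and on well-formed terms it agrees with
the reverse translation (`reverseTranslation_eq_readback`).

Lifting, opening, closing and substitution all act on a readback through its environments alone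
(`Src.Equivariant.readback`). Applied to closing and substitution, this removes the fresh names used
by unwrapping; applied to opening, it shows that contracting a source beta redex amounts to reading
back the projecting substitution (`Tgt.openAt_readback_body`). Readback maps tuples to tuples,
closures to abstractions, and keeps applications and projections. A closed term has no projected
variable outside closure bodies, so values, evaluation contexts and redexes correspond in both
directions. Well-formedness, which steps preserve (`Tgt.Proper.step`), supplies the side conditions
of target beta steps. Projection and reflection follow, and halting follows from these two.

The inverse property is proved for open terms, with environments that return the names eliminated
(`Src.IsTerm.readback_nameElim_wrap`). Wrapping and name elimination choose names separately;
`Mid.Scoped.nameElim_closure` makes the choice immaterial. -/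

theorem le_foldr_max {l : List ℕ} {x : ℕ} (h : x ∈ l) : x ≤ l.foldr max 0 := by
  induction l with
  | nil => simp at h
  | cons a l ih =>
    rcases List.mem_cons.1 h with rfl | h
    · simp
    · simp [ih h]

theorem foldr_max_le_iff {l : List ℕ} {n : ℕ} : l.foldr max 0 ≤ n ↔ ∀ x ∈ l, x ≤ n := by
  induction l with
  | nil => simp
  | cons a l ih => simp [ih]

@[simp] theorem length_freshNames (l : List Name) (n : ℕ) : (freshNames l n).length = n := by
  simp [freshNames]

theorem nodup_freshNames (l : List Name) (n : ℕ) : (freshNames l n).Nodup :=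
  List.nodup_range'

theorem notMem_of_mem_freshNames {l : List Name} {n : ℕ} {x : Name} (h : x ∈ freshNames l n) :
    x ∉ l := by
  intro hx
  have := le_foldr_max hx
  simp only [freshNames, List.mem_range'_1] at h
  omega

theorem notMem_freshNames {l : List Name} {n : ℕ} {x : Name} (h : x ∈ l) :
    x ∉ freshNames l n := fun hx => notMem_of_mem_freshNames hx h

/-! ### Lifting of dangling bound variables -/

namespace Src

/-- Shift the bound variables that refer to the `c`-th enclosing binder sequence or beyond. -/
def lift (c : ℕ) : Src → Src
  | .fvar x => .fvar x
  | .bvar j i => if c ≤ j then .bvar (j + 1) i else .bvar j i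
  | .app t u => .app (lift c t) (lift c u)
  | .proj i t => .proj i (lift c t)
  | .lam m t => .lam m (lift (c + 1) t)
  | .tup ts => .tup (ts.map (fun t => lift c t))

/-- Terms without dangling bound variables, as fixed points of all liftings. -/
def LiftInvariant (t : Src) : Prop := ∀ c, lift c t = t

theorem lift_lift {c d : ℕ} (h : c ≤ d) (t : Src) :
    lift (d + 1) (lift c t) = lift c (lift d t) := by
  induction c, t using lift.induct generalizing d with
  | case1 => simp [lift]
  | case2 c j i hj =>
    by_cases hd : d ≤ j
    · simp [lift, hj, hd, show c ≤ j + 1 by omega]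
    · simp [lift, hj, hd]
  | case3 c j i hj =>
    simp [lift, hj, show ¬ d ≤ j by omega, show ¬ d + 1 ≤ j by omega]
  | case4 c t u iht ihu => simp [lift, iht h, ihu h]
  | case5 c i t ih => simp [lift, ih h]
  | case6 c m t ih => simp [lift, ih (Nat.succ_le_succ h)]
  | case7 c ts ih =>
    simp only [lift, List.map_map]
    exact congrArg Src.tup (List.map_congr_left fun t ht => ih t ht h)

theorem closeAt_lift {c k : ℕ} (h : c ≤ k) (xs : List Name) (t : Src) :
    closeAt (k + 1) xs (lift c t) = lift c (closeAt k xs t) := by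
  induction c, t using lift.induct generalizing k with
  | case1 c x => by_cases hx : x ∈ xs <;> simp [lift, closeAt, hx, h]
  | case2 c j i hj => simp [lift, closeAt, hj]
  | case3 c j i hj => simp [lift, closeAt, hj]
  | case4 c t u iht ihu => simp [lift, closeAt, iht h, ihu h]
  | case5 c i t ih => simp [lift, closeAt, ih h]
  | case6 c m t ih => simp [lift, closeAt, ih (Nat.succ_le_succ h)]
  | case7 c ts ih =>
    simp only [lift, closeAt, List.map_map]
    exact congrArg Src.tup (List.map_congr_left fun t ht => ih t ht h)

/-- `openAt` inserts `us` under binders without shifting them, so the commutation needs them to be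
invariant under lifting. -/
theorem openAt_lift {c k : ℕ} (h : c ≤ k) {us : List Src} (hus : ∀ u ∈ us, LiftInvariant u)
    (t : Src) : openAt (k + 1) us (lift c t) = lift c (openAt k us t) := by
  induction c, t using lift.induct generalizing k with
  | case1 c x => simp [lift, openAt]
  | case2 c j i hj =>
    by_cases hk : j = k
    · subst hk
      rcases hi : us[i]? with _ | u
      · simp [lift, openAt, hj, List.getD_eq_getElem?_getD, hi]
      · simp [lift, openAt, hj, List.getD_eq_getElem?_getD, hi,
          hus u (List.mem_of_getElem? hi) c]
    · simp [lift, openAt, hj, hk]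
  | case3 c j i hj =>
    simp [lift, openAt, hj, show j ≠ k by omega, show j ≠ k + 1 by omega]
  | case4 c t u iht ihu => simp [lift, openAt, iht h, ihu h]
  | case5 c i t ih => simp [lift, openAt, ih h]
  | case6 c m t ih => simp [lift, openAt, ih (Nat.succ_le_succ h)]
  | case7 c ts ih =>
    simp only [lift, openAt, List.map_map]
    exact congrArg Src.tup (List.map_congr_left fun t ht => ih t ht h)

/-- A fixed point of `lift c` has no dangling variable at level `c` or beyond, hence nothing to open
there. -/
theorem openAt_eq_of_lift_eq {c k : ℕ} (h : c ≤ k) (us : List Src) {t : Src}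
    (ht : lift c t = t) : openAt k us t = t := by
  induction c, t using lift.induct generalizing k with
  | case1 c x => simp [openAt]
  | case2 c j i hj => simp [lift, hj] at ht
  | case3 c j i hj => simp [openAt, show j ≠ k by omega]
  | case4 c t u iht ihu =>
    simp only [lift, app.injEq] at ht
    simp [openAt, iht h ht.1, ihu h ht.2]
  | case5 c i t ih =>
    simp only [lift, proj.injEq, true_and] at ht
    simp [openAt, ih h ht]
  | case6 c m t ih =>
    simp only [lift, lam.injEq, true_and] at ht
    simp [openAt, ih (Nat.succ_le_succ h) ht]
  | case7 c ts ih =>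
    simp only [lift, tup.injEq] at ht
    have ht' : ts.map (fun t => lift c t) = ts.map id := by simpa using ht
    rw [List.map_inj_left] at ht'
    simp only [openAt]
    exact congrArg Src.tup ((List.map_congr_left fun t h' => ih t h' h (ht' t h')).trans
      (List.map_id _))

theorem subst_lift (c : ℕ) (xs : List Name) {us : List Src} (hus : ∀ u ∈ us, LiftInvariant u)
    (t : Src) : subst xs us (lift c t) = lift c (subst xs us t) := by
  induction c, t using lift.induct with
  | case1 c x =>
    by_cases hx : x ∈ xs
    · rcases hi : us[xs.idxOf x]? with _ | u
      · simp [lift, subst, hx, List.getD_eq_getElem?_getD, hi]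
      · simp [lift, subst, hx, List.getD_eq_getElem?_getD, hi,
          hus u (List.mem_of_getElem? hi) c]
    · simp [lift, subst, hx]
  | case2 c j i hj => simp [lift, subst, hj]
  | case3 c j i hj => simp [lift, subst, hj]
  | case4 c t u iht ihu => simp [lift, subst, iht, ihu]
  | case5 c i t ih => simp [lift, subst, ih]
  | case6 c m t ih => simp [lift, subst, ih]
  | case7 c ts ih =>
    simp only [lift, subst, List.map_map]
    exact congrArg Src.tup (List.map_congr_left fun t ht => ih t ht)

theorem closeAt_openAt (k : ℕ) {xs : List Name} (hxs : xs.Nodup) (t : Src)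
    (ht : ∀ x ∈ t.fv, x ∉ xs) : closeAt k xs (openAt k (xs.map Src.fvar) t) = t := by
  induction k, t using closeAt.induct (xs := xs) with
  | case1 k x hx => exact absurd hx (ht x (by simp [fv]))
  | case2 k x hx => simp [openAt, closeAt, hx]
  | case3 k j i =>
    by_cases hj : j = k
    · subst hj
      rcases hi : xs[i]? with _ | x
      -- An out-of-range index is left in place by both operations, so `t` may have arbitrary
      -- dangling variables.
      · simp [openAt, closeAt, List.getD_eq_getElem?_getD, hi]
      · obtain ⟨hlt, rfl⟩ := List.getElem?_eq_some_iff.1 hi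
        simp [openAt, closeAt, List.getD_eq_getElem?_getD, hlt, hxs.idxOf_getElem]
    · simp [openAt, closeAt, hj]
  | case4 k t u iht ihu =>
    simp only [fv, List.mem_append] at ht
    simp [openAt, closeAt, iht fun x hx => ht x (.inl hx), ihu fun x hx => ht x (.inr hx)]
  | case5 k i t ih => simp [openAt, closeAt, ih (by simpa [fv] using ht)]
  | case6 k m t ih => simp [openAt, closeAt, ih (by simpa [fv] using ht)]
  | case7 k ts ih =>
    simp only [fv, List.mem_flatMap] at ht
    simp only [openAt, closeAt, List.map_map]
    exact congrArg Src.tup ((List.map_congr_left fun t h =>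
      ih t h fun x hx => ht x ⟨t, h, hx⟩).trans (List.map_id _))

/-- Families of operations on terms, indexed by the number of binders above, that commute with
the constructors and with lifting. -/
structure Equivariant (h : ℕ → Src → Src) : Prop where
  app : ∀ k t u, h k (.app t u) = .app (h k t) (h k u)
  proj : ∀ k i t, h k (.proj i t) = .proj i (h k t)
  lam : ∀ k m t, h k (.lam m t) = .lam m (h (k + 1) t)
  tup : ∀ k ts, h k (.tup ts) = .tup (ts.map (h k))
  bvar : ∀ k i, h (k + 1) (.bvar 0 i) = .bvar 0 i
  lift : ∀ k t, h (k + 1) (Src.lift 0 t) = Src.lift 0 (h k t)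

theorem equivariant_lift : Equivariant lift where
  app _ _ _ := by simp [lift]
  proj _ _ _ := by simp [lift]
  lam _ _ _ := by simp [lift]
  tup _ _ := by simp [lift]
  bvar _ _ := by simp [lift]
  lift k t := lift_lift (Nat.zero_le k) t

theorem equivariant_closeAt (xs : List Name) : Equivariant (closeAt · xs) where
  app _ _ _ := by simp [closeAt]
  proj _ _ _ := by simp [closeAt]
  lam _ _ _ := by simp [closeAt]
  tup _ _ := by simp [closeAt]
  bvar _ _ := by simp [closeAt]
  lift k t := closeAt_lift (Nat.zero_le k) xs t

theorem equivariant_openAt {us : List Src} (hus : ∀ u ∈ us, LiftInvariant u) :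
    Equivariant (openAt · us) where
  app _ _ _ := by simp [openAt]
  proj _ _ _ := by simp [openAt]
  lam _ _ _ := by simp [openAt]
  tup _ _ := by simp [openAt]
  bvar _ _ := by simp [openAt]
  lift k t := openAt_lift (Nat.zero_le k) hus t

theorem equivariant_subst (xs : List Name) {us : List Src} (hus : ∀ u ∈ us, LiftInvariant u) :
    Equivariant (fun _ => subst xs us) where
  app _ _ _ := by simp [subst]
  proj _ _ _ := by simp [subst]
  lam _ _ _ := by simp [subst]
  tup _ _ := by simp [subst]
  bvar _ _ := by simp [subst]
  lift _ t := subst_lift 0 xs hus t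

end Src

/-! ### A direct description of the reverse translation -/

namespace Tgt

/-- The source term denoted by a target term, given the denotations of the projected variables. -/
def readback (σ τ : ℕ → Src) : Tgt → Src
  | .projL i => σ i
  | .projS i => τ i
  | .proj i t => .proj i (readback σ τ t)
  | .tup ts => .tup (ts.map (fun t => readback σ τ t))
  | .app t u => .app (readback σ τ t) (readback σ τ u)
  | .clos _ m t b =>
    .lam m (readback (fun i => (b.map (fun u => (readback σ τ u).lift 0)).getD i (.bvar 0 0))
      (fun i => .bvar 0 i) t)

theorem normL_le_of_mem {t : Tgt} {ts : List Tgt} (h : t ∈ ts) :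
    normL t ≤ (ts.map (fun t => normL t)).foldr max 0 :=
  le_foldr_max (List.mem_map_of_mem (f := fun t => normL t) h)

theorem normS_le_of_mem {t : Tgt} {ts : List Tgt} (h : t ∈ ts) :
    normS t ≤ (ts.map (fun t => normS t)).foldr max 0 :=
  le_foldr_max (List.mem_map_of_mem (f := fun t => normS t) h)

/-- The environments enter a closure only through its bag, so the induction is along `normL`, which
skips closure bodies exactly as the norms do. -/
theorem readback_congr {σ σ' τ τ' : ℕ → Src} (t : Tgt) (hσ : ∀ i < normL t, σ i = σ' i)
    (hτ : ∀ i < normS t, τ i = τ' i) : readback σ τ t = readback σ' τ' t := by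
  induction t using normL.induct with
  | case1 i => simp [readback, hσ i (by simp [normL])]
  | case2 i => simp [readback, hτ i (by simp [normS])]
  | case3 i t ih => simp [readback, ih (by simpa [normL] using hσ) (by simpa [normS] using hτ)]
  | case4 ts ih =>
    simp only [normL, normS] at hσ hτ
    simp only [readback]
    exact congrArg Src.tup (List.map_congr_left fun t ht => ih t ht
      (fun i hi => hσ i (hi.trans_le (normL_le_of_mem ht)))
      (fun i hi => hτ i (hi.trans_le (normS_le_of_mem ht))))
  | case5 t u iht ihu =>
    simp only [normL, normS] at hσ hτ
    simp only [readback]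
    rw [iht (fun i hi => hσ i (hi.trans_le (le_max_left _ _)))
        (fun i hi => hτ i (hi.trans_le (le_max_left _ _))),
      ihu (fun i hi => hσ i (hi.trans_le (le_max_right _ _)))
        (fun i hi => hτ i (hi.trans_le (le_max_right _ _)))]
  | case6 n m t b ihb =>
    simp only [normL, normS] at hσ hτ
    have : b.map (fun u => (readback σ τ u).lift 0) = b.map (fun u => (readback σ' τ' u).lift 0) :=
      List.map_congr_left fun t ht => congrArg _ (ihb t ht
        (fun i hi => hσ i (hi.trans_le (normL_le_of_mem ht)))
        (fun i hi => hτ i (hi.trans_le (normS_le_of_mem ht))))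
    simp only [readback, this]

/-- Structural induction through tuples, bags and bodies, borrowed from the recursion of `naming`;
the name sequences play no role. -/
theorem rec_on_mem {p : Tgt → Prop} (projL : ∀ i, p (.projL i)) (projS : ∀ i, p (.projS i))
    (proj : ∀ i t, p t → p (.proj i t)) (tup : ∀ ts, (∀ t ∈ ts, p t) → p (.tup ts))
    (app : ∀ t u, p t → p u → p (.app t u))
    (clos : ∀ n m t b, p t → (∀ u ∈ b, p u) → p (.clos n m t b)) (t : Tgt) : p t :=
  naming.induct (fun _ _ t => p t) (fun _ _ => projL) (fun _ _ => projS) (fun _ _ => proj)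
    (fun _ _ => tup) (fun _ _ => app) (fun _ _ => clos) [] [] t

/-- Inside a closure body the environments contain only lifted bag entries and bound parameters. At
level `k + 1` the operation passes through the lifting of the former and fixes the latter. -/
theorem _root_.ClosureConversion.Src.Equivariant.readback {h : ℕ → Src → Src}
    (hh : Src.Equivariant h) (k : ℕ) (σ τ : ℕ → Src) (t : Tgt) :
    h k (readback σ τ t) = readback (fun i => h k (σ i)) (fun i => h k (τ i)) t := by
  induction t using rec_on_mem generalizing k σ τ with
  | projL i => simp [Tgt.readback]
  | projS i => simp [Tgt.readback]
  | proj i t ih => simp [Tgt.readback, hh.proj, ih]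
  | tup ts ih =>
    simp only [Tgt.readback, hh.tup, List.map_map]
    exact congrArg Src.tup (List.map_congr_left fun t ht => ih t ht k σ τ)
  | app t u iht ihu => simp [Tgt.readback, hh.app, iht, ihu]
  | clos n m t b iht ihb =>
    simp only [Tgt.readback, hh.lam, iht, hh.bvar]
    congr 2
    funext i
    rcases hi : b[i]? with _ | u
    -- Beyond the bag the environment returns `.bvar 0 0`, itself fixed at level `k + 1`, so no
    -- bound on the norms is needed.
    · simp [List.getD_eq_getElem?_getD, hi, hh.bvar]
    · simp [List.getD_eq_getElem?_getD, hi, hh.lift, ihb u (List.mem_of_getElem? hi)]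

theorem liftInvariant_readback {σ τ : ℕ → Src} (hσ : ∀ i, (σ i).LiftInvariant)
    (hτ : ∀ i, (τ i).LiftInvariant) (t : Tgt) : (readback σ τ t).LiftInvariant := fun c => by
  have h := Src.equivariant_lift.readback c σ τ t
  simpa only [hσ _ c, hτ _ c] using h

/-- The substitution lemma: substituting and then reading is reading in the environment of the read
substituents. The defaults `d`, `e` are free because the norm bounds keep every index in range. -/
theorem readback_psubst (σ τ : ℕ → Src) (vs ws : List Tgt) (t : Tgt)
    (hL : normL t ≤ vs.length) (hS : normS t ≤ ws.length) (d e : ℕ → Src) :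
    readback σ τ (psubst vs ws t) =
      readback (fun i => (vs.map (readback σ τ)).getD i (d i))
        (fun i => (ws.map (readback σ τ)).getD i (e i)) t := by
  induction t using normL.induct with
  | case1 i =>
    have hi : i < vs.length := by simpa only [normL, Nat.add_one_le_iff] using hL
    simp [psubst, readback, hi]
  | case2 i =>
    have hi : i < ws.length := by simpa only [normS, Nat.add_one_le_iff] using hS
    simp [psubst, readback, hi]
  | case3 i t ih =>
    simp only [normL, normS] at hL hS
    simp only [psubst, readback, ih hL hS]
  | case4 ts ih =>
    simp only [normL, normS] at hL hS
    simp only [psubst, readback, List.map_map]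
    exact congrArg Src.tup (List.map_congr_left fun t ht => ih t ht
      ((normL_le_of_mem ht).trans hL) ((normS_le_of_mem ht).trans hS))
  | case5 t u iht ihu =>
    simp only [normL, normS, max_le_iff] at hL hS
    simp only [psubst, readback, iht hL.1 hS.1, ihu hL.2 hS.2]
  | case6 n m t b ihb =>
    simp only [normL, normS] at hL hS
    simp only [psubst, readback, List.map_map]
    congr 2
    funext i
    congr 1
    refine List.map_congr_left fun t ht => ?_
    simp only [Function.comp_apply]
    rw [ihb t ht ((normL_le_of_mem ht).trans hL) ((normS_le_of_mem ht).trans hS)]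

/-! ### Steps of closed well-formed terms -/

theorem isClosed_tup {ts : List Tgt} : (tup ts).IsClosed ↔ ∀ t ∈ ts, t.IsClosed := by
  simp only [IsClosed, normL, normS, ← Nat.le_zero, foldr_max_le_iff, List.forall_mem_map]
  grind

theorem isClosed_clos {n m : ℕ} {t : Tgt} {b : List Tgt} :
    (clos n m t b).IsClosed ↔ ∀ u ∈ b, u.IsClosed := by
  rw [← isClosed_tup]
  simp [IsClosed, normL, normS]

theorem isClosed_app {t u : Tgt} : (app t u).IsClosed ↔ t.IsClosed ∧ u.IsClosed := by
  simp only [IsClosed, normL, normS]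
  omega

theorem isClosed_proj {i : ℕ} {t : Tgt} : (proj i t).IsClosed ↔ t.IsClosed := by
  simp only [IsClosed, normL, normS]

theorem IsValue.psubst {v : Tgt} (hv : IsValue v) (vs ws : List Tgt) :
    IsValue (psubst vs ws v) := by
  induction hv with
  | clos n m t b => simpa only [Tgt.psubst] using .clos ..
  | tup us _ ih =>
    simp only [Tgt.psubst]
    refine .tup _ ?_
    simpa using ih

/-- Closed terms which are well-formed. -/
structure Proper (t : Tgt) : Prop where
  wf : t.WellFormed
  closed : t.IsClosed

theorem proper_tup {ts : List Tgt} : (tup ts).Proper ↔ ∀ t ∈ ts, t.Proper := by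
  refine ⟨fun ⟨h, hc⟩ t ht => ?_, fun h => ⟨.tup _ fun t ht => (h t ht).wf,
    isClosed_tup.2 fun t ht => (h t ht).closed⟩⟩
  cases h with
  | tup _ h => exact ⟨h t ht, isClosed_tup.1 hc t ht⟩

theorem proper_app {t u : Tgt} : (app t u).Proper ↔ t.Proper ∧ u.Proper := by
  refine ⟨fun ⟨h, hc⟩ => ?_, fun ⟨h, h'⟩ => ⟨.app _ _ h.wf h'.wf,
    isClosed_app.2 ⟨h.closed, h'.closed⟩⟩⟩
  cases h with
  | app _ _ h h' => exact ⟨⟨h, (isClosed_app.1 hc).1⟩, ⟨h', (isClosed_app.1 hc).2⟩⟩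

theorem proper_proj {i : ℕ} {t : Tgt} : (proj i t).Proper ↔ t.Proper := by
  refine ⟨fun ⟨h, hc⟩ => ?_, fun h => ⟨.proj _ _ h.wf, isClosed_proj.2 h.closed⟩⟩
  cases h with
  | proj _ _ h => exact ⟨h, isClosed_proj.1 hc⟩

theorem not_proper_projL {i : ℕ} : ¬ (projL i).Proper := fun h => by
  simpa [normL] using h.closed.1

theorem not_proper_projS {i : ℕ} : ¬ (projS i).Proper := fun h => by
  simpa [normS] using h.closed.2

theorem Proper.psubst {vs ws : List Tgt} (hvs : ∀ v ∈ vs, v.Proper ∧ v.IsValue)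
    (hws : ∀ w ∈ ws, w.Proper ∧ w.IsValue) {t : Tgt} (ht : t.WellFormed)
    (hL : normL t ≤ vs.length) (hS : normS t ≤ ws.length) : (psubst vs ws t).Proper := by
  induction ht with
  | projL i =>
    have hi : i < vs.length := by simpa only [normL, Nat.add_one_le_iff] using hL
    simpa [Tgt.psubst, hi] using (hvs _ (List.getElem_mem hi)).1
  | projS i =>
    have hi : i < ws.length := by simpa only [normS, Nat.add_one_le_iff] using hS
    simpa [Tgt.psubst, hi] using (hws _ (List.getElem_mem hi)).1
  | proj i t _ ih =>
    simp only [normL, normS] at hL hS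
    simpa only [Tgt.psubst, proper_proj] using ih hL hS
  | tup ts _ ih =>
    simp only [normL, normS] at hL hS
    simp only [Tgt.psubst, proper_tup, List.forall_mem_map]
    exact fun t ht => ih t ht ((normL_le_of_mem ht).trans hL) ((normS_le_of_mem ht).trans hS)
  | app t u _ _ iht ihu =>
    simp only [normL, normS, max_le_iff] at hL hS
    simpa only [Tgt.psubst, proper_app] using ⟨iht hL.1 hS.1, ihu hL.2 hS.2⟩
  | clos n m t b ht hb hbag hn hm hlen _ ihb =>
    simp only [normL, normS] at hL hS
    have key : ∀ u ∈ b, (Tgt.psubst vs ws u).Proper := fun u hu =>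
      ihb u hu ((normL_le_of_mem hu).trans hL) ((normS_le_of_mem hu).trans hS)
    simp only [Tgt.psubst]
    -- Either kind of bag becomes a bag of values: projected variables are replaced by values, and
    -- values stay values.
    refine ⟨.clos _ _ _ _ ht ?_ (.inr ?_) hn hm (by simpa using hlen), ?_⟩
    · simpa only [List.forall_mem_map] using fun u hu => (key u hu).wf
    · simp only [List.forall_mem_map]
      intro u hu
      rcases hbag with h | h
      · have hu' := h u hu
        have h1 := (normL_le_of_mem hu).trans hL
        have h2 := (normS_le_of_mem hu).trans hS
        cases hu' with
        | projL i =>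
          have hi : i < vs.length := by simpa only [normL, Nat.add_one_le_iff] using h1
          simpa [Tgt.psubst, hi] using (hvs _ (List.getElem_mem hi)).2
        | projS i =>
          have hi : i < ws.length := by simpa only [normS, Nat.add_one_le_iff] using h2
          simpa [Tgt.psubst, hi] using (hws _ (List.getElem_mem hi)).2
      · exact (h u hu).psubst vs ws
    · simpa only [isClosed_clos, List.forall_mem_map] using fun u hu => (key u hu).closed

/-- A projected variable in the bag would be free in the closure, so closedness leaves only bags of
values. -/
theorem Proper.bag {n m : ℕ} {t : Tgt} {b : List Tgt} (h : (clos n m t b).Proper) :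
    ∀ u ∈ b, u.Proper ∧ u.IsValue := by
  obtain ⟨h, hc⟩ := h
  rw [isClosed_clos] at hc
  cases h with
  | clos _ _ _ _ ht hb hbag =>
    refine fun u hu => ⟨⟨hb u hu, hc u hu⟩, ?_⟩
    rcases hbag with h | h
    · have hu' := h u hu
      cases hu' with
      | projL => exact absurd ⟨hb _ hu, hc _ hu⟩ not_proper_projL
      | projS => exact absurd ⟨hb _ hu, hc _ hu⟩ not_proper_projS
    · exact h u hu

theorem Proper.step {a : StepKind} {t u : Tgt} (ht : t.Proper) (h : Step a t u) : u.Proper := by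
  induction h with
  | root t u h =>
    cases h with
    | beta n m t vs ws _ hws hn hm =>
      obtain ⟨h1, h2⟩ := proper_app.1 ht
      cases h1.wf with
      | clos _ _ _ _ ht _ _ hL hS =>
        exact .psubst h1.bag (fun w hw => ⟨proper_tup.1 h2 w hw, hws w hw⟩) ht
          (hn ▸ hL) (hm ▸ hS)
    | proj i vs _ _ hv => exact proper_tup.1 (proper_proj.1 ht) _ (List.mem_of_getElem? hv)
  | appR t u u₁ _ ih => exact proper_app.2 ⟨(proper_app.1 ht).1, ih (proper_app.1 ht).2⟩
  | appL t t₁ v _ _ ih => exact proper_app.2 ⟨ih (proper_app.1 ht).1, (proper_app.1 ht).2⟩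
  | proj i t t₁ _ ih => exact proper_proj.2 (ih (proper_proj.1 ht))
  | tup ts vs t t₁ _ _ ih =>
    rw [proper_tup] at ht ⊢
    intro s hs
    simp only [List.mem_append, List.mem_cons] at hs ht
    rcases hs with hs | rfl | hs
    · exact ht s (.inl hs)
    · exact ih (ht t (.inr (.inl rfl)))
    · exact ht s (.inr (.inr hs))

/-! ### Values and steps under readback -/

theorem isValue_readback {σ τ : ℕ → Src} {v : Tgt} (hv : v.IsValue) :
    (readback σ τ v).IsValue := by
  induction hv with
  | clos n m t b => simpa only [readback] using .lam ..
  | tup vs _ ih =>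
    simp only [readback]
    refine .tup _ ?_
    simpa using ih

/-- Closedness is essential: a projected variable is not a value, but its denotation may be one. -/
theorem isValue_of_readback {σ τ : ℕ → Src} {t : Tgt} (ht : t.Proper)
    (hv : (readback σ τ t).IsValue) : t.IsValue := by
  induction t using normL.induct with
  | case1 i => exact absurd ht not_proper_projL
  | case2 i => exact absurd ht not_proper_projS
  | case3 i t => simp only [readback] at hv; cases hv
  | case4 ts ih =>
    simp only [readback] at hv
    cases hv with
    | tup _ h =>
      rw [List.forall_mem_map] at h
      exact .tup _ fun t hmem => ih t hmem (proper_tup.1 ht t hmem) (h t hmem)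
  | case5 t u => simp only [readback] at hv; cases hv
  | case6 n m t b => exact .clos ..

/-- Readback of a closure body, with the arguments substituted. -/
theorem openAt_readback_body {σ τ : ℕ → Src} (hσ : ∀ i, (σ i).LiftInvariant)
    (hτ : ∀ i, (τ i).LiftInvariant) {vs ws : List Tgt} {t : Tgt} (hL : normL t ≤ vs.length)
    (hS : normS t ≤ ws.length) :
    Src.openAt 0 (ws.map (fun w => readback σ τ w))
      (readback (fun i => (vs.map (fun u => (readback σ τ u).lift 0)).getD i (.bvar 0 0))
        (fun i => .bvar 0 i) t) = readback σ τ (psubst vs ws t) := by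
  have hinv := liftInvariant_readback hσ hτ
  have hws : ∀ u ∈ ws.map (fun w => readback σ τ w), u.LiftInvariant := by
    simpa using fun w _ => hinv w
  -- Opening reaches the body only through its environments: it leaves the lift-invariant bag
  -- entries alone and turns the parameters `.bvar 0 i` into the arguments. This is the environment
  -- given by the substitution lemma.
  rw [(Src.equivariant_openAt hws).readback 0, readback_psubst σ τ vs ws t hL hS σ τ]
  refine readback_congr t (fun i hi => ?_) fun i hi => ?_
  · have hi' := hi.trans_le hL
    simp [hi', hinv _ 0, Src.openAt_eq_of_lift_eq le_rfl _ (hinv _ 0)]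
  · have hi' := hi.trans_le hS
    simp [hi', Src.openAt]

theorem step_readback {σ τ : ℕ → Src} (hσ : ∀ i, (σ i).LiftInvariant)
    (hτ : ∀ i, (τ i).LiftInvariant) {a : StepKind} {t u : Tgt} (ht : t.Proper) (h : Step a t u) :
    Src.Step a (readback σ τ t) (readback σ τ u) := by
  induction h with
  | root t u h =>
    cases h with
    | beta n m t vs ws hvs hws hn hm =>
      cases (proper_app.1 ht).1.wf with
      | clos _ _ _ _ ht _ _ hL hS =>
        simp only [readback]
        rw [← openAt_readback_body hσ hτ (hn ▸ hL) (hm ▸ hS)]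
        refine .root _ _ (.beta _ _ _ ?_ (by simpa using hm))
        simpa using fun w hw => isValue_readback (hws w hw)
    | proj i vs _ hvs hv =>
      simp only [readback]
      refine .root _ _ (.proj _ _ _ ?_ (by simp [hv]))
      simpa using fun w hw => isValue_readback (hvs w hw)
  | appR t u u₁ _ ih => simpa only [readback] using .appR _ _ _ (ih (proper_app.1 ht).2)
  | appL t t₁ v hv _ ih =>
    simpa only [readback] using .appL _ _ _ (isValue_readback hv) (ih (proper_app.1 ht).1)
  | proj i t t₁ _ ih => simpa only [readback] using .proj _ _ _ (ih (proper_proj.1 ht))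
  | tup ts vs t t₁ hvs _ ih =>
    simp only [readback, List.map_append, List.map_cons]
    refine .tup _ _ _ _ ?_ (ih (proper_tup.1 ht t (by simp)))
    simpa using fun w hw => isValue_readback (hvs w hw)

/-- On closed terms the head constructor of the readback determines that of the target term, so a
source redex can come only from a target redex in the same position. -/
theorem exists_step_of_readback {σ τ : ℕ → Src} (hσ : ∀ i, (σ i).LiftInvariant)
    (hτ : ∀ i, (τ i).LiftInvariant) {a : StepKind} {t : Tgt} {u : Src} (ht : t.Proper)
    (h : Src.Step a (readback σ τ t) u) : ∃ s, Step a t s ∧ readback σ τ s = u := by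
  induction t using normL.induct generalizing u with
  | case1 i => exact absurd ht not_proper_projL
  | case2 i => exact absurd ht not_proper_projS
  | case3 i t ih =>
    rw [proper_proj] at ht
    simp only [readback] at h
    generalize hr : readback σ τ t = r at h
    cases h with
    | root _ _ h =>
      cases h with
      | proj _ vs _ hvs hv =>
        cases t with
        | tup ts =>
          simp only [readback, Src.tup.injEq] at hr
          subst hr
          rw [List.getElem?_map, Option.map_eq_some_iff] at hv
          obtain ⟨w, hw, rfl⟩ := hv
          rw [List.forall_mem_map] at hvs
          exact ⟨w, .root _ _ (.proj _ _ _ (fun v hv => isValue_of_readback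
            (proper_tup.1 ht v hv) (hvs v hv)) hw), rfl⟩
        | projL => exact absurd ht not_proper_projL
        | projS => exact absurd ht not_proper_projS
        | _ => simp [readback] at hr
    | proj _ _ t₁ h =>
      subst hr
      obtain ⟨s, hs, rfl⟩ := ih ht h
      exact ⟨_, .proj _ _ _ hs, by simp only [readback]⟩
  | case4 ts ih =>
    rw [proper_tup] at ht
    simp only [readback] at h
    generalize hr : ts.map (fun t => readback σ τ t) = r at h
    cases h with
    | root _ _ h => cases h
    | tup us vs r r₁ hvs h =>
      obtain ⟨ts₁, ts₂, rfl, rfl, h₂⟩ := List.map_eq_append_iff.1 hr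
      obtain ⟨t, ts₂, rfl, rfl, rfl⟩ := List.map_eq_cons_iff.1 h₂
      obtain ⟨s, hs, rfl⟩ := ih t (by simp) (ht t (by simp)) h
      rw [List.forall_mem_map] at hvs
      exact ⟨_, .tup _ _ _ _ (fun v hv => isValue_of_readback (ht v (by simp [hv]))
        (hvs v hv)) hs, by simp only [readback, List.map_append, List.map_cons]⟩
  | case5 t w iht ihw =>
    rw [proper_app] at ht
    obtain ⟨ht, hw⟩ := ht
    simp only [readback] at h
    generalize hr : readback σ τ t = r at h
    generalize hr' : readback σ τ w = r' at h
    cases h with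
    | root _ _ h =>
      cases h with
      | beta m r vs hvs hm =>
        cases t with
        | clos n m' t b =>
          cases w with
          | tup ws =>
            simp only [readback, Src.tup.injEq, Src.lam.injEq] at hr hr'
            obtain ⟨rfl, rfl⟩ := hr
            subst hr'
            rw [List.length_map] at hm
            rw [List.forall_mem_map] at hvs
            -- The source rule only checks the number of arguments. Well-formedness provides the
            -- remaining condition, that the bag has length `n`, and the norm bounds.
            cases ht.wf with
            | clos _ _ _ _ _ _ _ hL hS hn =>
              exact ⟨_, .root _ _ (.beta _ _ _ _ _ (fun v hv => (ht.bag v hv).2)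
                (fun v hv => isValue_of_readback (proper_tup.1 hw v hv) (hvs v hv)) hn.symm hm),
                (openAt_readback_body hσ hτ (hn ▸ hL) (hm ▸ hS)).symm⟩
          | projL => exact absurd hw not_proper_projL
          | projS => exact absurd hw not_proper_projS
          | _ => simp [readback] at hr'
        | projL => exact absurd ht not_proper_projL
        | projS => exact absurd ht not_proper_projS
        | _ => simp [readback] at hr
    | appR _ _ u₁ h =>
      subst hr hr'
      obtain ⟨s, hs, rfl⟩ := ihw hw h
      exact ⟨_, .appR _ _ _ hs, by simp only [readback]⟩
    | appL _ t₁ _ hv h =>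
      subst hr hr'
      obtain ⟨s, hs, rfl⟩ := iht ht h
      exact ⟨_, .appL _ _ _ (isValue_of_readback hw hv) hs, by simp only [readback]⟩
  | case6 n m t b =>
    simp only [readback] at h
    cases h with
    | root _ _ h => cases h

end Tgt

/-! ### A direct description of naming -/

namespace Tgt

/-- Naming in locally nameless style, given the denotations of the projected variables. -/
def toMid (f g : ℕ → Mid) : Tgt → Mid
  | .projL i => f i
  | .projS i => g i
  | .proj i t => .proj i (toMid f g t)
  | .tup ts => .tup (ts.map (fun t => toMid f g t))
  | .app t u => .app (toMid f g t) (toMid f g u)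
  | .clos n m t b => .clos n m (toMid (.bvar 1) (.bvar 0) t) (b.map (fun u => toMid f g u))

theorem toMid_congr {f f' g g' : ℕ → Mid} (t : Tgt) (hf : ∀ i < normL t, f i = f' i)
    (hg : ∀ i < normS t, g i = g' i) : toMid f g t = toMid f' g' t := by
  induction t using normL.induct with
  | case1 i => simp [toMid, hf i (by simp [normL])]
  | case2 i => simp [toMid, hg i (by simp [normS])]
  | case3 i t ih => simp [toMid, ih (by simpa [normL] using hf) (by simpa [normS] using hg)]
  | case4 ts ih =>
    simp only [normL, normS] at hf hg
    simp only [toMid]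
    exact congrArg Mid.tup (List.map_congr_left fun t ht => ih t ht
      (fun i hi => hf i (hi.trans_le (normL_le_of_mem ht)))
      (fun i hi => hg i (hi.trans_le (normS_le_of_mem ht))))
  | case5 t u iht ihu =>
    simp only [normL, normS] at hf hg
    simp only [toMid]
    rw [iht (fun i hi => hf i (hi.trans_le (le_max_left _ _)))
        (fun i hi => hg i (hi.trans_le (le_max_left _ _))),
      ihu (fun i hi => hf i (hi.trans_le (le_max_right _ _)))
        (fun i hi => hg i (hi.trans_le (le_max_right _ _)))]
  | case6 n m t b ihb =>
    simp only [normL, normS] at hf hg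
    simp only [toMid]
    exact congrArg (Mid.clos n m _) (List.map_congr_left fun t ht => ihb t ht
      (fun i hi => hf i (hi.trans_le (normL_le_of_mem ht)))
      (fun i hi => hg i (hi.trans_le (normS_le_of_mem ht))))

/-- A closure body is built from its own variables `.bvar 1 i` and `.bvar 0 i`, which closing does
not touch; only the environments are affected. -/
theorem closeAt_toMid (k : ℕ) (xs : List Name) (f g : ℕ → Mid) (t : Tgt) :
    (toMid f g t).closeAt k xs =
      toMid (fun i => (f i).closeAt k xs) (fun i => (g i).closeAt k xs) t := by
  induction t using rec_on_mem generalizing k f g with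
  | projL i => simp [toMid]
  | projS i => simp [toMid]
  | proj i t ih => simp [toMid, Mid.closeAt, ih]
  | tup ts ih =>
    simp only [toMid, Mid.closeAt, List.map_map]
    exact congrArg Mid.tup (List.map_congr_left fun t ht => ih t ht k f g)
  | app t u iht ihu => simp [toMid, Mid.closeAt, iht, ihu]
  | clos n m t b iht ihb =>
    simp only [toMid, Mid.closeAt, List.map_map, iht]
    exact congrArg (Mid.clos n m _) (List.map_congr_left fun t ht => ihb t ht k f g)

theorem openAt_toMid (k : ℕ) (xs : List Name) (f g : ℕ → Mid) (t : Tgt) :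
    (toMid f g t).openAt k xs =
      toMid (fun i => (f i).openAt k xs) (fun i => (g i).openAt k xs) t := by
  induction t using rec_on_mem generalizing k f g with
  | projL i => simp [toMid]
  | projS i => simp [toMid]
  | proj i t ih => simp [toMid, Mid.openAt, ih]
  | tup ts ih =>
    simp only [toMid, Mid.openAt, List.map_map]
    exact congrArg Mid.tup (List.map_congr_left fun t ht => ih t ht k f g)
  | app t u iht ihu => simp [toMid, Mid.openAt, iht, ihu]
  | clos n m t b iht ihb =>
    simp only [toMid, Mid.openAt, List.map_map, iht]
    simp only [show 1 ≠ k + 2 by omega, show 0 ≠ k + 2 by omega, if_false]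
    exact congrArg (Mid.clos n m _) (List.map_congr_left fun t ht => ihb t ht k f g)

/-- The fresh names given to a body are bound again at once, and so disappear; the norm bounds
ensure that every index receives one of them. -/
theorem naming_eq_toMid {t : Tgt} (ht : t.WellFormed) (ys xs : List Name) :
    naming ys xs t = toMid (fun i => .fvar (ys.getD i 0)) (fun i => .fvar (xs.getD i 0)) t := by
  induction ht generalizing ys xs with
  | projL i => simp [naming, toMid]
  | projS i => simp [naming, toMid]
  | proj i t _ ih => simp only [naming, toMid, ih]
  | tup ts _ ih =>
    simp only [naming, toMid]
    exact congrArg Mid.tup (List.map_congr_left fun t ht => ih t ht ys xs)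
  | app t u _ _ iht ihu => simp only [naming, toMid, iht, ihu]
  | clos n m t b ht hb hbag hL hS hlen iht ihb =>
    simp only [naming, toMid, Mid.closure, iht, closeAt_toMid, length_freshNames]
    rw [List.map_congr_left fun u hu => ihb u hu ys xs]
    congr 1
    refine toMid_congr t (fun i hi => ?_) (fun i hi => ?_)
    · have hi' : i < (freshNames (ys ++ xs) n).length := by simpa using hi.trans_le hL
      have hmem := List.getElem_mem hi'
      -- The source names are bound first, so the wrapped names must survive that closing.
      have : (freshNames (ys ++ xs) n)[i] ∉ freshNames (ys ++ xs ++ freshNames (ys ++ xs) n) m :=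
        notMem_freshNames (List.mem_append_right _ hmem)
      rw [List.getD_eq_getElem _ _ hi']
      simp only [Mid.closeAt, this, if_false]
      simp [(nodup_freshNames _ _).idxOf_getElem]
    · have hi' : i < (freshNames (ys ++ xs ++ freshNames (ys ++ xs) n) m).length := by
        simpa using hi.trans_le hS
      rw [List.getD_eq_getElem _ _ hi']
      simp [Mid.closeAt, (nodup_freshNames _ _).idxOf_getElem]

/-! ### Unwrapping a named term is readback -/

theorem openBody_toMid {ys xs : List Name} {t : Tgt} (hL : normL t ≤ ys.length)
    (hS : normS t ≤ xs.length) :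
    (toMid (.bvar 1) (.bvar 0) t).openBody ys xs =
      toMid (fun i => .fvar (ys.getD i 0)) (fun i => .fvar (xs.getD i 0)) t := by
  rw [Mid.openBody, openAt_toMid, openAt_toMid]
  refine toMid_congr t (fun i hi => ?_) (fun i hi => ?_)
  · simp [Mid.openAt, hi.trans_le hL]
  · simp [Mid.openAt, hi.trans_le hS]

/-- Rules out capture when unwrapped bag entries are placed under the abstraction of fresh names.
Closure bodies contribute no names of their own, so only bags need the induction. -/
theorem closeAt_readback_of_fresh (f g : ℕ → Name) {xs : List Name} {t : Tgt}
    (h : ∀ x ∈ (toMid (fun i => .fvar (f i)) (fun i => .fvar (g i)) t).fv, x ∉ xs) (k : ℕ) :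
    (readback (fun i => .fvar (f i)) (fun i => .fvar (g i)) t).closeAt k xs =
      readback (fun i => .fvar (f i)) (fun i => .fvar (g i)) t := by
  induction t using normL.induct generalizing k with
  | case1 i => simpa [readback, Src.closeAt, toMid, Mid.fv] using h
  | case2 i => simpa [readback, Src.closeAt, toMid, Mid.fv] using h
  | case3 i t ih =>
    simp only [toMid, Mid.fv] at h
    simp only [readback, Src.closeAt, ih h]
  | case4 ts ih =>
    simp only [toMid, Mid.fv, List.mem_flatMap, List.mem_map] at h
    simp only [readback, Src.closeAt, List.map_map]
    exact congrArg Src.tup (List.map_congr_left fun t ht => ih t ht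
      (fun x hx => h x ⟨_, ⟨t, ht, rfl⟩, hx⟩) k)
  | case5 t u iht ihu =>
    simp only [toMid, Mid.fv, List.mem_append] at h
    simp only [readback, Src.closeAt, iht (fun x hx => h x (.inl hx)),
      ihu (fun x hx => h x (.inr hx))]
  | case6 n m t b ihb =>
    simp only [toMid, Mid.fv, List.mem_append, List.mem_flatMap, List.mem_map] at h
    simp only [readback, Src.closeAt]
    rw [(Src.equivariant_closeAt xs).readback (k + 1)]
    simp only [Src.closeAt]
    congr 2
    funext i
    rcases hi : b[i]? with _ | u
    · simp [List.getD_eq_getElem?_getD, hi, Src.closeAt]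
    · have hu := List.mem_of_getElem? hi
      simp only [List.getD_eq_getElem?_getD, List.getElem?_map, hi, Option.map_some,
        Option.getD_some]
      rw [Src.closeAt_lift (Nat.zero_le k), ihb u hu fun x hx => h x (.inr ⟨_, ⟨u, hu, rfl⟩, hx⟩)]

theorem unwrap_toMid {t : Tgt} (ht : t.WellFormed) (f g : ℕ → Name) :
    unwrap (toMid (fun i => .fvar (f i)) (fun i => .fvar (g i)) t) =
      readback (fun i => .fvar (f i)) (fun i => .fvar (g i)) t := by
  induction ht generalizing f g with
  | projL i => simp [unwrap, readback, toMid]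
  | projS i => simp [unwrap, readback, toMid]
  | proj i t _ ih => simp only [unwrap, readback, toMid, ih]
  | tup ts _ ih =>
    simp only [unwrap, readback, toMid, List.map_map]
    exact congrArg Src.tup (List.map_congr_left fun t ht => ih t ht f g)
  | app t u _ _ iht ihu => simp only [unwrap, readback, toMid, iht, ihu]
  | clos n m t b ht hb hbag hL hS hlen iht ihb =>
    simp only [toMid, unwrap]
    set avoid := (Mid.clos n m (toMid (.bvar 1) (.bvar 0) t)
      (b.map fun u => toMid (fun i => .fvar (f i)) (fun i => .fvar (g i)) u)).fv with havoid
    set ys := freshNames avoid n with hys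
    set xs := freshNames (avoid ++ ys) m with hxs
    have hylen : ys.length = n := length_freshNames _ _
    have hxlen : xs.length = m := length_freshNames _ _
    have hbs : (b.map fun u => toMid (fun i => .fvar (f i)) (fun i => .fvar (g i)) u).map
        (fun u => unwrap u) =
        b.map fun u => readback (fun i => .fvar (f i)) (fun i => .fvar (g i)) u := by
      rw [List.map_map]
      exact List.map_congr_left fun u hu => ihb u hu f g
    rw [hbs, openBody_toMid (hL.trans_eq hylen.symm) (hS.trans_eq hxlen.symm), iht, Src.abs]
    have hfv : ∀ x, (Src.fvar x).LiftInvariant := fun x c => by simp [Src.lift]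
    have hinv := liftInvariant_readback (σ := fun i => .fvar (f i)) (τ := fun i => .fvar (g i))
      (fun i => hfv _) (fun i => hfv _)
    have hus : ∀ u ∈ b.map fun u => readback (fun i => .fvar (f i)) (fun i => .fvar (g i)) u,
        u.LiftInvariant := by
      simpa using fun u _ => hinv u
    -- Substituting the bag for `ys` and binding `xs` both move into the environments; it remains to
    -- compute the images of the names `ys[i]` and `xs[i]`.
    rw [(Src.equivariant_subst ys hus).readback 0, (Src.equivariant_closeAt xs).readback 0, hxlen]
    simp only [readback]
    refine congrArg (Src.lam m) (readback_congr t (fun i hi => ?_) fun i hi => ?_)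
    · have hi₁ : i < ys.length := hylen ▸ hi.trans_le hL
      have hi₂ : i < b.length := hlen ▸ hi.trans_le hL
      have hnd : ys.idxOf ys[i] = i := (nodup_freshNames avoid n).idxOf_getElem i hi₁
      have hfresh := closeAt_readback_of_fresh f g (xs := xs) (t := b[i]) (fun x hx =>
        notMem_freshNames (List.mem_append_left _ (by
          rw [havoid]
          simp only [Mid.fv, List.mem_append, List.mem_flatMap, List.mem_map]
          exact .inr ⟨_, ⟨_, List.getElem_mem hi₂, rfl⟩, hx⟩))) 0
      simp [Src.subst, hi₁, hi₂, hnd, hinv _ 0, hfresh]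
    · have hi₁ : i < xs.length := hxlen ▸ hi.trans_le hS
      have hnd : xs.idxOf xs[i] = i := (nodup_freshNames _ m).idxOf_getElem i hi₁
      have hmem : xs[i] ∉ ys := fun h =>
        notMem_of_mem_freshNames (List.getElem_mem hi₁) (List.mem_append_right _ h)
      simp [Src.subst, Src.closeAt, hi₁, hnd, hmem]

end Tgt

/-- The name `0` is the default returned by empty name sequences; a closed term never consults it.
-/
theorem reverseTranslation_eq_readback {t : Tgt} (ht : t.WellFormed) :
    reverseTranslation t = t.readback (fun _ => .fvar 0) (fun _ => .fvar 0) := by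
  rw [reverseTranslation, Tgt.naming_eq_toMid ht]
  exact Tgt.unwrap_toMid ht _ _

/-! ### Scopes of intermediate terms, and a direct description of name elimination -/

namespace Mid

/-- The free names of the term satisfy `P`, its dangling bound variables satisfy `Q`, and the
variables of closure bodies are bound by the closure. -/
inductive Scoped : (Name → Prop) → (ℕ → ℕ → Prop) → Mid → Prop
  | fvar {P Q} (x : Name) : P x → Scoped P Q (.fvar x)
  | bvar {P Q} (k i : ℕ) : Q k i → Scoped P Q (.bvar k i)
  | app {P Q} (t u : Mid) : Scoped P Q t → Scoped P Q u → Scoped P Q (.app t u)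
  | proj {P Q} (i : ℕ) (t : Mid) : Scoped P Q t → Scoped P Q (.proj i t)
  | tup {P Q} (ts : List Mid) : (∀ t ∈ ts, Scoped P Q t) → Scoped P Q (.tup ts)
  | clos {P Q} (n m : ℕ) (t : Mid) (b : List Mid) :
      Scoped (fun _ => False) (fun k i => k = 0 ∧ i < m ∨ k = 1 ∧ i < n) t →
      (∀ u ∈ b, Scoped P Q u) → Scoped P Q (.clos n m t b)

variable {P P' : Name → Prop} {Q Q' : ℕ → ℕ → Prop} {t : Mid}

theorem Scoped.mono (h : Scoped P Q t) (hP : ∀ x, P x → P' x) (hQ : ∀ k i, Q k i → Q' k i) :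
    Scoped P' Q' t := by
  induction h generalizing P' Q' with
  | fvar x h => exact .fvar _ (hP _ h)
  | bvar k i h => exact .bvar _ _ (hQ _ _ h)
  | app t u _ _ iht ihu => exact .app _ _ (iht hP hQ) (ihu hP hQ)
  | proj i t _ ih => exact .proj _ _ (ih hP hQ)
  | tup ts _ ih => exact .tup _ fun t ht => ih t ht hP hQ
  | clos n m t b ht _ _ ihb => exact .clos _ _ _ _ ht fun u hu => ihb u hu hP hQ

theorem Scoped.closeAt_eq (h : Scoped P Q t) {xs : List Name} (hP : ∀ x, P x → x ∉ xs) (k : ℕ) :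
    closeAt k xs t = t := by
  induction h generalizing k with
  | fvar x h => simp [closeAt, hP x h]
  | bvar k i h => simp [closeAt]
  | app t u _ _ iht ihu => simp [closeAt, iht hP, ihu hP]
  | proj i t _ ih => simp [closeAt, ih hP]
  | tup ts _ ih =>
    simp only [closeAt]
    exact congrArg Mid.tup ((List.map_congr_left fun t ht => ih t ht hP k).trans (List.map_id _))
  | clos n m t b _ _ iht ihb =>
    simp only [closeAt]
    rw [iht (fun _ h => h.elim), (List.map_congr_left fun t ht => ihb t ht hP k).trans
      (List.map_id _)]

theorem Scoped.openAt_eq (h : Scoped P Q t) {k : ℕ} (hQ : ∀ i, ¬ Q k i) (xs : List Name) :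
    openAt k xs t = t := by
  induction h generalizing k with
  | fvar x h => simp [openAt]
  | bvar j i h =>
    have : j ≠ k := fun e => hQ i (e ▸ h)
    simp [openAt, this]
  | app t u _ _ iht ihu => simp [openAt, iht hQ, ihu hQ]
  | proj i t _ ih => simp [openAt, ih hQ]
  | tup ts _ ih =>
    simp only [openAt]
    exact congrArg Mid.tup ((List.map_congr_left fun t ht => ih t ht hQ).trans (List.map_id _))
  | clos n m t b _ _ iht ihb =>
    simp only [openAt]
    rw [iht (by omega), (List.map_congr_left fun t ht => ihb t ht hQ).trans (List.map_id _)]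

/-- With no free names and no variables of outer binders, a closure body is unaffected by closing
from outside, and likewise by opening. Inductions on scoped terms can therefore skip bodies. -/
theorem Scoped.closeAt_body {n m : ℕ}
    (h : Scoped (fun _ => False) (fun k i => k = 0 ∧ i < m ∨ k = 1 ∧ i < n) t) (k : ℕ)
    (xs : List Name) : Mid.closeAt k xs t = t := h.closeAt_eq (fun _ h => h.elim) k

theorem Scoped.openAt_body {n m : ℕ}
    (h : Scoped (fun _ => False) (fun k i => k = 0 ∧ i < m ∨ k = 1 ∧ i < n) t) (k : ℕ)
    (xs : List Name) : Mid.openAt (k + 2) xs t = t := h.openAt_eq (by omega) xs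

theorem Scoped.closeAt (h : Scoped P Q t) (k : ℕ) (xs : List Name) :
    Scoped (fun x => P x ∧ x ∉ xs) (fun j i => Q j i ∨ j = k ∧ i < xs.length)
      (Mid.closeAt k xs t) := by
  induction h generalizing k with
  | fvar x h =>
    by_cases hx : x ∈ xs
    · simpa [Mid.closeAt, hx] using .bvar _ _ (.inr ⟨rfl, List.idxOf_lt_length_of_mem hx⟩)
    · simpa [Mid.closeAt, hx] using .fvar _ ⟨h, hx⟩
  | bvar j i h => simpa only [Mid.closeAt] using .bvar _ _ (.inl h)
  | app t u _ _ iht ihu => simpa only [Mid.closeAt] using .app _ _ (iht k) (ihu k)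
  | proj i t _ ih => simpa only [Mid.closeAt] using .proj _ _ (ih k)
  | tup ts _ ih =>
    simp only [Mid.closeAt]
    exact .tup _ (List.forall_mem_map.2 fun t ht => ih t ht k)
  | clos n m t b ht _ _ ihb =>
    simp only [Mid.closeAt, ht.closeAt_body]
    exact .clos _ _ _ _ ht (List.forall_mem_map.2 fun t ht => ihb t ht k)

theorem Scoped.openAt (h : Scoped P Q t) {k : ℕ} {xs : List Name}
    (hQ : ∀ i, Q k i → i < xs.length) :
    Scoped (fun x => P x ∨ x ∈ xs) (fun j i => Q j i ∧ j ≠ k) (Mid.openAt k xs t) := by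
  induction h with
  | fvar x h => simpa only [Mid.openAt] using .fvar _ (.inl h)
  | bvar j i h =>
    by_cases hj : j = k
    · subst hj
      have hi := hQ i h
      simpa [Mid.openAt, hi] using .fvar _ (.inr (List.getElem_mem hi))
    · simpa [Mid.openAt, hj] using .bvar _ _ ⟨h, hj⟩
  | app t u _ _ iht ihu => simpa only [Mid.openAt] using .app _ _ (iht hQ) (ihu hQ)
  | proj i t _ ih => simpa only [Mid.openAt] using .proj _ _ (ih hQ)
  | tup ts _ ih =>
    simp only [Mid.openAt]
    exact .tup _ (List.forall_mem_map.2 fun t ht => ih t ht hQ)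
  | clos n m t b ht _ _ ihb =>
    simp only [Mid.openAt, ht.openAt_body]
    exact .clos _ _ _ _ ht (List.forall_mem_map.2 fun t ht => ihb t ht hQ)

/-- Name elimination in locally nameless style, given the images of the variables. -/
def elim (f : Name → Tgt) (g : ℕ → ℕ → Tgt) : Mid → Tgt
  | .fvar x => f x
  | .bvar k i => g k i
  | .app t u => .app (elim f g t) (elim f g u)
  | .proj i t => .proj i (elim f g t)
  | .tup ts => .tup (ts.map (fun t => elim f g t))
  | .clos n m t b =>
    .clos n m (elim (fun _ => .projS 0) (fun k i => if k = 1 then .projL i else .projS i) t)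
      (b.map (fun u => elim f g u))

theorem Scoped.elim_congr (h : Scoped P Q t) {f f' : Name → Tgt} {g g' : ℕ → ℕ → Tgt}
    (hf : ∀ x, P x → f x = f' x) (hg : ∀ k i, Q k i → g k i = g' k i) :
    elim f g t = elim f' g' t := by
  induction h with
  | fvar x h => simp [elim, hf x h]
  | bvar k i h => simp [elim, hg k i h]
  | app t u _ _ iht ihu => simp [elim, iht hf hg, ihu hf hg]
  | proj i t _ ih => simp [elim, ih hf hg]
  | tup ts _ ih =>
    simp only [elim]
    exact congrArg Tgt.tup (List.map_congr_left fun t ht => ih t ht hf hg)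
  | clos n m t b _ _ _ ihb =>
    simp only [elim]
    exact congrArg (Tgt.clos n m _) (List.map_congr_left fun t ht => ihb t ht hf hg)

theorem Scoped.elim_closeAt (h : Scoped P Q t) (f : Name → Tgt) (g : ℕ → ℕ → Tgt) (k : ℕ)
    (xs : List Name) :
    elim f g (Mid.closeAt k xs t) = elim (fun x => if x ∈ xs then g k (xs.idxOf x) else f x) g t := by
  induction h with
  | fvar x h => by_cases hx : x ∈ xs <;> simp [elim, Mid.closeAt, hx]
  | bvar k i h => simp [elim, Mid.closeAt]
  | app t u _ _ iht ihu => simp only [elim, Mid.closeAt, iht, ihu]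
  | proj i t _ ih => simp only [elim, Mid.closeAt, ih]
  | tup ts _ ih =>
    simp only [elim, Mid.closeAt, List.map_map]
    exact congrArg Tgt.tup (List.map_congr_left ih)
  | clos n m t b ht _ _ ihb =>
    simp only [elim, Mid.closeAt, ht.closeAt_body, List.map_map]
    exact congrArg (Tgt.clos n m _) (List.map_congr_left ihb)

theorem Scoped.elim_openAt (h : Scoped P Q t) (f : Name → Tgt) (g : ℕ → ℕ → Tgt) (k : ℕ)
    (xs : List Name) :
    elim f g (Mid.openAt k xs t) =
      elim f (fun j i => if j = k then (xs[i]?.map f).getD (g j i) else g j i) t := by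
  induction h with
  | fvar x h => simp [elim, Mid.openAt]
  | bvar j i h =>
    by_cases hj : j = k
    · rcases hi : xs[i]? with _ | x <;> simp [elim, Mid.openAt, hj, hi]
    · simp [elim, Mid.openAt, hj]
  | app t u _ _ iht ihu => simp only [elim, Mid.openAt, iht, ihu]
  | proj i t _ ih => simp only [elim, Mid.openAt, ih]
  | tup ts _ ih =>
    simp only [elim, Mid.openAt, List.map_map]
    exact congrArg Tgt.tup (List.map_congr_left ih)
  | clos n m t b ht _ _ ihb =>
    simp only [elim, Mid.openAt, ht.openAt_body, List.map_map]
    exact congrArg (Tgt.clos n m _) (List.map_congr_left ihb)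

/-- Opening a body with fresh names and then eliminating them returns each variable to its position,
so the names leave no trace. The image of dangling variables copies the junk value of `nameElim`. -/
theorem Scoped.nameElim_eq_elim (h : Scoped P Q t) (ys xs : List Name) :
    nameElim ys xs t = elim (fun z => if z ∈ ys then .projL (ys.idxOf z) else .projS (xs.idxOf z))
      (fun _ i => .projS i) t := by
  induction ys, xs, t using nameElim.induct generalizing P Q with
  | case1 => simp [nameElim, elim]
  | case2 => simp [nameElim, elim]
  | case3 => simp [nameElim, elim]
  | case4 ys xs t u iht ihu =>
    cases h with
    | app _ _ ht hu => simp only [nameElim, elim, iht ht, ihu hu]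
  | case5 ys xs i t ih =>
    cases h with
    | proj _ _ ht => simp only [nameElim, elim, ih ht]
  | case6 ys xs ts ih =>
    cases h with
    | tup _ h =>
      simp only [nameElim, elim]
      exact congrArg Tgt.tup (List.map_congr_left fun t ht => ih t ht (h t ht))
  | case7 ys xs n m t b zs ws =>
    rename_i iht ihb
    cases h with
    | clos _ _ _ _ ht hb =>
      simp only [nameElim, elim]
      rw [List.map_congr_left fun u hu => ihb u hu (hb u hu)]
      congr 1
      have hz : zs.length = n := length_freshNames _ _
      have hw : ws.length = m := length_freshNames _ _
      have h₀ := ht.openAt (k := 0) (xs := ws) (by omega)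
      have h₁ := h₀.openAt (k := 1) (xs := zs) (by omega)
      refine (iht h₁).trans ?_
      rw [openBody, h₀.elim_openAt, ht.elim_openAt]
      refine ht.elim_congr (fun _ h => h.elim) fun k i hki => ?_
      rcases hki with ⟨rfl, hi⟩ | ⟨rfl, hi⟩
      · have hi' : i < ws.length := hw ▸ hi
        have hnd : ws.idxOf ws[i] = i := (nodup_freshNames _ m).idxOf_getElem i hi'
        have hmem : ws[i] ∉ zs := fun h =>
          notMem_of_mem_freshNames (List.getElem_mem hi') (List.mem_append_right _ h)
        simp [hi', hnd, hmem]
      · have hi' : i < zs.length := hz ▸ hi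
        have hnd : zs.idxOf zs[i] = i := (nodup_freshNames _ n).idxOf_getElem i hi'
        simp [hi', hnd]

theorem Scoped.closure {ys xs : List Name} (ht : Scoped (fun x => x ∈ ys ∨ x ∈ xs)
    (fun _ _ => False) t) {b : List Mid} (hb : ∀ u ∈ b, Scoped P Q u) :
    Scoped P Q (Mid.closure ys xs t b) :=
  .clos _ _ _ _ (((ht.closeAt 0 xs).closeAt 1 ys).mono (by tauto) (by tauto)) hb

/-- Name elimination does not depend on the names chosen for the variables of a closure. -/
theorem Scoped.nameElim_closure {ys xs : List Name} (ht : Scoped (fun x => x ∈ ys ∨ x ∈ xs)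
    (fun _ _ => False) t) (hd : ∀ x ∈ ys, x ∉ xs) {b : List Mid} (hb : ∀ u ∈ b, Scoped P Q u)
    (ys' xs' : List Name) :
    nameElim ys' xs' (Mid.closure ys xs t b) =
      .clos ys.length xs.length (nameElim ys xs t) (b.map fun u => nameElim ys' xs' u) := by
  rw [(ht.closure hb).nameElim_eq_elim, ht.nameElim_eq_elim,
    List.map_congr_left fun u hu => (hb u hu).nameElim_eq_elim ys' xs']
  simp only [Mid.closure, elim]
  rw [(ht.closeAt 0 xs).elim_closeAt, ht.elim_closeAt]
  congr 1
  refine ht.elim_congr (fun x hx => ?_) fun _ _ h => h.elim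
  -- `Mid.closure` binds `xs` before `ys`, whereas `nameElim` tests `ys` first; disjointness
  -- reconciles the two orders.
  by_cases hy : x ∈ ys
  · simp [hy, hd x hy]
  · simp [hy, hx.resolve_left hy]

end Mid

/-! ### Wrapping -/

namespace Src

/-- The opened binder is the outermost one, hence last in the context; a general `ctx` in front of
it lets the induction go under abstractions. -/
theorem LCAt.openAt {ctx : List ℕ} {xs : List Name} {t : Src} (h : LCAt (ctx ++ [xs.length]) t) :
    LCAt ctx (Src.openAt ctx.length (xs.map Src.fvar) t) := by
  generalize hc : ctx ++ [xs.length] = c at h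
  induction h generalizing ctx with
  | fvar _ x => simpa only [Src.openAt] using .fvar _ _
  | bvar _ k i n hk hi =>
    subst hc
    by_cases hkc : k = ctx.length
    · have hn : n = xs.length := by simpa [hkc, eq_comm] using hk
      have hi' : i < xs.length := hn ▸ hi
      simpa [Src.openAt, hkc, hi'] using .fvar _ _
    · have hlt : k < ctx.length := by
        have := (List.getElem?_eq_some_iff.1 hk).1
        simp only [List.length_append, List.length_singleton] at this
        omega
      rw [List.getElem?_append_left hlt] at hk
      simpa [Src.openAt, hkc] using .bvar _ _ _ _ hk hi
  | app _ t u _ _ iht ihu => simpa only [Src.openAt] using .app _ _ _ (iht hc) (ihu hc)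
  | proj _ i t _ ih => simpa only [Src.openAt] using .proj _ _ _ (ih hc)
  | lam _ m t _ ih =>
    simp only [Src.openAt]
    exact .lam _ _ _ (ih (ctx := m :: ctx) (by simp [hc]))
  | tup _ ts _ ih =>
    simp only [Src.openAt]
    exact .tup _ _ (List.forall_mem_map.2 fun t ht => ih t ht hc)

theorem mem_fv_openAt {k : ℕ} {xs : List Name} {t : Src} {x : Name}
    (h : x ∈ (openAt k (xs.map Src.fvar) t).fv) : x ∈ t.fv ∨ x ∈ xs := by
  induction k, t using openAt.induct with
  | case1 k y => exact .inl (by simpa only [openAt] using h)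
  | case2 k i =>
    rcases hi : xs[i]? with _ | y
    · simp [openAt, List.getD_eq_getElem?_getD, hi, fv] at h
    · simp only [openAt, List.getD_eq_getElem?_getD, List.getElem?_map, hi, if_true,
        Option.map_some, Option.getD_some, fv, List.mem_singleton] at h
      exact .inr (h ▸ List.mem_of_getElem? hi)
  | case3 k j i hj => simp [openAt, hj, fv] at h
  | case4 k t u iht ihu =>
    simp only [openAt, fv, List.mem_append] at h ⊢
    rcases h with h | h
    · exact (iht h).imp_left .inl
    · exact (ihu h).imp_left .inr
  | case5 k i t ih =>
    simp only [openAt, fv] at h ⊢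
    exact ih h
  | case6 k m t ih =>
    simp only [openAt, fv] at h ⊢
    exact ih h
  | case7 k ts ih =>
    simp only [openAt, fv, List.mem_flatMap, List.mem_map] at h ⊢
    obtain ⟨_, ⟨t, ht, rfl⟩, h⟩ := h
    exact (ih t ht h).imp_left fun h => ⟨t, ht, h⟩

theorem IsTerm.open_body {m : ℕ} {t : Src} (h : (lam m t).IsTerm) (l : List Name) :
    (openAt 0 ((freshNames l m).map Src.fvar) t).IsTerm := by
  cases h with
  | lam _ _ _ h => exact LCAt.openAt (ctx := []) (by simpa using h)

theorem mem_fv_open_body {m : ℕ} {t : Src} {x : Name}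
    (h : x ∈ (openAt 0 ((freshNames t.fv m).map Src.fvar) t).fv) :
    x ∈ t.fv.dedup ∨ x ∈ freshNames t.fv m := by
  simpa using mem_fv_openAt h

/-- Every name in the body of a wrapped abstraction is one of its free variables or a fresh
parameter, and the closure binds both. -/
theorem IsTerm.scoped_wrap {u : Src} (hu : u.IsTerm) :
    (wrap u).Scoped (· ∈ u.fv) (fun _ _ => False) := by
  induction u using wrap.induct with
  | case1 x => simpa only [wrap] using .fvar _ (by simp [fv])
  | case2 k i =>
    cases hu with
    | bvar _ _ _ _ h => simp at h
  | case3 t u iht ihu =>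
    cases hu with
    | app _ _ _ ht hu =>
      simp only [wrap, fv]
      exact .app _ _ ((iht ht).mono (by grind) (by simp)) ((ihu hu).mono (by grind) (by simp))
  | case4 i t ih =>
    cases hu with
    | proj _ _ _ ht =>
      simp only [wrap, fv]
      exact .proj _ _ (ih ht)
  | case5 m t xs ih =>
    simp only [wrap]
    refine ((ih (hu.open_body _)).mono (fun x hx => mem_fv_open_body hx) (by simp)).closure ?_
    simp only [List.forall_mem_map, fv]
    exact fun x hx => .fvar _ (List.mem_dedup.1 hx)
  | case6 ts ih =>
    cases hu with
    | tup _ _ h =>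
      simp only [wrap, fv]
      exact .tup _ (List.forall_mem_map.2 fun t ht => (ih t ht (h t ht)).mono
        (fun x hx => List.mem_flatMap.2 ⟨t, ht, hx⟩) (by simp))

/-- Name elimination of a wrapped abstraction. -/
theorem IsTerm.nameElim_wrap_lam {m : ℕ} {t : Src} (h : (lam m t).IsTerm) (ys xs : List Name) :
    nameElim ys xs (wrap (lam m t)) =
      .clos t.fv.dedup.length m (nameElim t.fv.dedup (freshNames t.fv m)
        (wrap (openAt 0 ((freshNames t.fv m).map Src.fvar) t)))
        (t.fv.dedup.map fun x => nameElim ys xs (.fvar x)) := by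
  have hs := ((h.open_body t.fv).scoped_wrap).mono (P' := fun x => x ∈ t.fv.dedup ∨
    x ∈ freshNames t.fv m) (Q' := fun _ _ => False) (fun x hx => mem_fv_open_body hx) (by simp)
  simp only [wrap]
  -- The names picked by `wrap` are kept in place of those `nameElim` would pick, so that induction
  -- along `wrap` applies to the body.
  rw [hs.nameElim_closure (P := fun _ => True) (Q := fun _ _ => True)
    (fun x hx => notMem_freshNames (List.mem_dedup.1 hx))
    (List.forall_mem_map.2 fun x _ => .fvar _ trivial), List.map_map, length_freshNames]
  rfl

/-! ### Closure conversion of open terms: well-formedness and readback -/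

theorem wellFormed_nameElim_fvar {ys xs : List Name} {x : Name} (hx : x ∈ ys ∨ x ∈ xs) :
    (nameElim ys xs (.fvar x)).WellFormed ∧ (nameElim ys xs (.fvar x)).normL ≤ ys.length ∧
      (nameElim ys xs (.fvar x)).normS ≤ xs.length ∧ (nameElim ys xs (.fvar x)).IsProjVar := by
  by_cases hy : x ∈ ys
  · simpa [nameElim, hy, Tgt.normL, Tgt.normS, List.idxOf_lt_length_of_mem hy,
      Nat.add_one_le_iff] using ⟨.projL _, .projL _⟩
  · simpa [nameElim, hy, Tgt.normL, Tgt.normS, Nat.add_one_le_iff,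
      List.idxOf_lt_length_of_mem (hx.resolve_left hy)] using ⟨.projS _, .projS _⟩

/-- The norm bounds belong to the induction because well-formedness of a closure requires them of
its body. -/
theorem IsTerm.wellFormed_nameElim_wrap {u : Src} (hu : u.IsTerm) {ys xs : List Name}
    (hfv : ∀ x ∈ u.fv, x ∈ ys ∨ x ∈ xs) :
    (nameElim ys xs (wrap u)).WellFormed ∧ (nameElim ys xs (wrap u)).normL ≤ ys.length ∧
      (nameElim ys xs (wrap u)).normS ≤ xs.length := by
  induction u using wrap.induct generalizing ys xs with
  | case1 x =>
    simp only [wrap]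
    have h := wellFormed_nameElim_fvar (hfv x (by simp [fv]))
    exact ⟨h.1, h.2.1, h.2.2.1⟩
  | case2 k i =>
    cases hu with
    | bvar _ _ _ _ h => simp at h
  | case3 t u iht ihu =>
    cases hu with
    | app _ _ _ ht hu =>
      simp only [fv, List.mem_append] at hfv
      obtain ⟨h₁, h₂, h₃⟩ := iht ht (fun x hx => hfv x (.inl hx))
      obtain ⟨h₁', h₂', h₃'⟩ := ihu hu (fun x hx => hfv x (.inr hx))
      simp only [wrap, nameElim, Tgt.normL, Tgt.normS]
      exact ⟨.app _ _ h₁ h₁', max_le h₂ h₂', max_le h₃ h₃'⟩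
  | case4 i t ih =>
    cases hu with
    | proj _ _ _ ht =>
      simp only [fv] at hfv
      obtain ⟨h₁, h₂, h₃⟩ := ih ht hfv
      simp only [wrap, nameElim, Tgt.normL, Tgt.normS]
      exact ⟨.proj _ _ h₁, h₂, h₃⟩
  | case5 m t zs ih =>
    have key := fun x (hx : x ∈ t.fv.dedup) =>
      wellFormed_nameElim_fvar (hfv x (by simpa only [fv] using List.mem_dedup.1 hx))
    obtain ⟨h₁, h₂, h₃⟩ := ih (hu.open_body _) (ys := t.fv.dedup) (xs := freshNames t.fv m)
      fun x hx => mem_fv_open_body hx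
    rw [hu.nameElim_wrap_lam]
    simp only [Tgt.normL, Tgt.normS, foldr_max_le_iff, List.forall_mem_map]
    refine ⟨.clos _ _ _ _ h₁ (List.forall_mem_map.2 fun x hx => (key x hx).1)
      (.inl (List.forall_mem_map.2 fun x hx => (key x hx).2.2.2)) h₂ (by simpa using h₃)
      (by simp), fun x hx => (key x hx).2.1, fun x hx => (key x hx).2.2.1⟩
  | case6 ts ih =>
    cases hu with
    | tup _ _ h =>
      simp only [fv, List.mem_flatMap] at hfv
      have key := fun t ht => ih t ht (h t ht) (fun x hx => hfv x ⟨t, ht, hx⟩)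
      simp only [wrap, nameElim, Tgt.normL, Tgt.normS, foldr_max_le_iff, List.forall_mem_map]
      exact ⟨.tup _ (by simpa only [List.forall_mem_map] using fun t ht => (key t ht).1),
        fun t ht => (key t ht).2.1, fun t ht => (key t ht).2.2⟩

theorem readback_nameElim_fvar {ys xs : List Name} {x : Name} (hx : x ∈ ys ∨ x ∈ xs) :
    (nameElim ys xs (.fvar x)).readback (fun i => .fvar (ys.getD i 0))
      (fun i => .fvar (xs.getD i 0)) = .fvar x := by
  by_cases hy : x ∈ ys
  · simp [nameElim, hy, Tgt.readback, List.idxOf_lt_length_of_mem hy]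
  · simp [nameElim, hy, Tgt.readback, List.idxOf_lt_length_of_mem (hx.resolve_left hy)]

theorem IsTerm.readback_nameElim_wrap {u : Src} (hu : u.IsTerm) {ys xs : List Name}
    (hfv : ∀ x ∈ u.fv, x ∈ ys ∨ x ∈ xs) :
    (nameElim ys xs (wrap u)).readback (fun i => .fvar (ys.getD i 0))
      (fun i => .fvar (xs.getD i 0)) = u := by
  induction u using wrap.induct generalizing ys xs with
  | case1 x =>
    simp only [wrap]
    exact readback_nameElim_fvar (hfv x (by simp [fv]))
  | case2 k i =>
    cases hu with
    | bvar _ _ _ _ h => simp at h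
  | case3 t u iht ihu =>
    cases hu with
    | app _ _ _ ht hu =>
      simp only [fv, List.mem_append] at hfv
      simp only [wrap, nameElim, Tgt.readback, iht ht fun x hx => hfv x (.inl hx),
        ihu hu fun x hx => hfv x (.inr hx)]
  | case4 i t ih =>
    cases hu with
    | proj _ _ _ ht =>
      simp only [fv] at hfv
      simp only [wrap, nameElim, Tgt.readback, ih ht hfv]
  | case5 m t zs ih =>
    have hfv' : ∀ x ∈ t.fv.dedup, x ∈ ys ∨ x ∈ xs :=
      fun x hx => hfv x (by simpa only [fv] using List.mem_dedup.1 hx)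
    have hfvb : ∀ x ∈ (openAt 0 ((freshNames t.fv m).map Src.fvar) t).fv,
        x ∈ t.fv.dedup ∨ x ∈ freshNames t.fv m := fun x hx => mem_fv_open_body hx
    obtain ⟨-, hL, hS⟩ := (hu.open_body t.fv).wellFormed_nameElim_wrap hfvb
    rw [hu.nameElim_wrap_lam]
    simp only [Tgt.readback, List.map_map]
    have hbag : t.fv.dedup.map ((fun u => Src.lift 0 (Tgt.readback (fun i => .fvar (ys.getD i 0))
        (fun i => .fvar (xs.getD i 0)) u)) ∘ fun x => nameElim ys xs (.fvar x)) =
        t.fv.dedup.map Src.fvar :=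
      List.map_congr_left fun x hx => by
        simp only [Function.comp_apply, readback_nameElim_fvar (hfv' x hx), Src.lift]
    have hclose := closeAt_openAt 0 (nodup_freshNames t.fv m) t fun x hx => notMem_freshNames hx
    -- By induction the opened body is itself a readback. Closing it recovers `t` and moves into the
    -- environments, so it suffices to compare environments below the norms.
    rw [← ih (hu.open_body _) hfvb, (equivariant_closeAt _).readback 0] at hclose
    rw [hbag]
    refine congrArg (lam m) (Eq.trans (Tgt.readback_congr _ (fun i hi => ?_) fun i hi => ?_)
      hclose)
    · have hi' := hi.trans_le hL
      have := notMem_freshNames (n := m) (List.mem_dedup.1 (List.getElem_mem hi'))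
      rw [List.getD_eq_getElem _ _ hi', List.getD_eq_getElem _ _ (by simpa using hi')]
      simp only [closeAt, this, if_false, List.getElem_map]
    · have hi' := hi.trans_le hS
      rw [List.getD_eq_getElem _ _ hi']
      simp [closeAt, (nodup_freshNames _ _).idxOf_getElem]
  | case6 ts ih =>
    cases hu with
    | tup _ _ h =>
      simp only [fv, List.mem_flatMap] at hfv
      simp only [wrap, nameElim, Tgt.readback, List.map_map]
      exact congrArg Src.tup ((List.map_congr_left fun t ht => ih t ht (h t ht)
        fun x hx => hfv x ⟨t, ht, hx⟩).trans (List.map_id _))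

end Src
end ClosureConversion

/-! ### The main theorem -/

open ClosureConversion in
theorem mainTheorem1 :
    (∀ t : Tgt, t.WellFormed → t.IsClosed →
      -- projection
      (∀ (a : StepKind) (u : Tgt), Tgt.Step a t u →
        Src.Step a (reverseTranslation t) (reverseTranslation u)) ∧
      -- halt
      (t.IsNormal ↔ (reverseTranslation t).IsNormal) ∧
      -- reflection
      (∀ (a : StepKind) (u : Src), Src.Step a (reverseTranslation t) u →
        ∃ s : Tgt, Tgt.Step a t s ∧ reverseTranslation s = u)) ∧
    -- inverse
    (∀ u : Src, u.IsTerm → u.IsClosed → reverseTranslation (closureConversion u) = u) := by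
  have hinv : ∀ _ : ℕ, (Src.fvar 0).LiftInvariant := fun _ c => by simp [Src.lift]
  refine ⟨fun t hw hc => ?_, fun u hu hc => ?_⟩
  · have ht : t.Proper := ⟨hw, hc⟩
    have projection : ∀ (a : StepKind) (u : Tgt), Tgt.Step a t u →
        Src.Step a (reverseTranslation t) (reverseTranslation u) := fun a u h => by
      rw [reverseTranslation_eq_readback hw, reverseTranslation_eq_readback (ht.step h).wf]
      exact Tgt.step_readback hinv hinv ht h
    have reflection : ∀ (a : StepKind) (u : Src), Src.Step a (reverseTranslation t) u →
        ∃ s : Tgt, Tgt.Step a t s ∧ reverseTranslation s = u := fun a u h => by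
      rw [reverseTranslation_eq_readback hw] at h
      obtain ⟨s, hs, rfl⟩ := Tgt.exists_step_of_readback hinv hinv ht h
      exact ⟨s, hs, reverseTranslation_eq_readback (ht.step hs).wf⟩
    -- A step on either side yields one on the other, so the two terms are normal together.
    refine ⟨projection, ⟨fun h a u hu => ?_, fun h a u hu => h a _ (projection a u hu)⟩,
      reflection⟩
    obtain ⟨s, hs, -⟩ := reflection a u hu
    exact h a s hs
  · have hfv : ∀ x ∈ u.fv, x ∈ ([] : List Name) ∨ x ∈ ([] : List Name) := by
      rw [show u.fv = [] from hc]
      simp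
    rw [closureConversion,
      reverseTranslation_eq_readback (hu.wellFormed_nameElim_wrap hfv).1]
    exact hu.readback_nameElim_wrap hfv
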